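/- Let $D$ be a connected smooth finite-dimensional Riemannian manifold, possibly with boundary (corners are allowed), with Riemannian distance $\mathsf d$ and finite Riemannian volume measure $\mathfrak m$. For Borel probability measures $\mu,\nu$ on $D$ let $$W_2^2(\mu,\nu)=\inf\Big\{\int_{D\times D}\mathsf d(x,y)^2\,d\Sigma(x,y)\;:\;\Sigma \text{ a Borel probability measure on } D\times D \text{ with marginals } \mu,\nu\Big\}\in[0,\infty],$$ and let $M(a,b)=\frac{a-b}{\log a-\log b}$ for $a,b>0$, $a\ne b$, with $M(a,a)=a$ and $M(a,0)=M(0,b)=M(0,0)=0$, be the logarithmic mean. Let $u_0,u_1\in L^2(\mathfrak m)$ be probability densities with respect to $\mathfrak m$, with $u_0>0$ $\mathfrak m$-a.e. Let $f\in H^{1,2}(D,\mathfrak m)$ (that is, $f\in L^2(\mathfrak m)$ has a weak gradient $\nabla f$ with $|\nabla f|\in L^2(\mathfrak m)$) be a weak solution of $\Delta f=u_1-u_0$ in $D$ with Neumann condition $\nabla f\cdot n_D=0$ on $\partial D$, in the sense that $$-\int_D\langle\nabla\phi,\nabla f\rangle\,d\mathfrak m=\int_D\phi\,(u_1-u_0)\,d\mathfrak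 m\qquad\text{for every bounded Lipschitz function } \phi:D\to\mathbb R.$$ Then $$W_2^2(u_0\mathfrak m,u_1\mathfrak m)\;\le\;\int_0^1\int_D\frac{|\nabla f|^2}{(1-s)u_0+s u_1}\,d\mathfrak m\,ds\;=\;\int_D\frac{|\nabla f|^2}{M(u_0,u_1)}\,d\mathfrak m ,$$ where the integrals take values in $[0,\infty]$, and in the integrands $0/0=0$ and $c/0=\infty$ for $c>0$. -/

import Mathlib

open MeasureTheory Set Bundle
open scoped Manifold ContDiff ENNReal

noncomputable section

/-- The set of couplings (transport plans) of two measures: the Borel measures on the product with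
first marginal `μ` and second marginal `ν`. -/
def transportPlans {X : Type*} [MeasurableSpace X] (μ ν : Measure X) : Set (Measure (X × X)) :=
  {P | P.map Prod.fst = μ ∧ P.map Prod.snd = ν}

/-- The squared quadratic Wasserstein distance: the least quadratic transport cost
`∫ d(x, y)² dP(x, y)` among all couplings `P`, as an extended nonnegative number. -/
def wassersteinSq {X : Type*} [PseudoEMetricSpace X] [MeasurableSpace X]
    (μ ν : Measure X) : ℝ≥0∞ :=
  ⨅ P ∈ transportPlans μ ν, ∫⁻ p, edist p.1 p.2 ^ 2 ∂P

/-- The logarithmic mean `(a - b) / (log a - log b)` of `a, b > 0` (equal to `a` if `a = b`),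
extended by `0` when one of the arguments vanishes. -/
def logMean (a b : ℝ) : ℝ :=
  if 0 < a ∧ 0 < b then
    if a = b then a else (a - b) / (Real.log a - Real.log b)
  else 0

/-- `u` is a probability density with respect to `m`. -/
structure IsProbabilityDensity {X : Type*} [MeasurableSpace X] (m : Measure X) (u : X → ℝ) :
    Prop where
  nonneg : ∀ᵐ x ∂m, 0 ≤ u x
  integrable : Integrable u m
  integral_eq_one : ∫ x, u x ∂m = 1

section Riemannian

variable {d : ℕ} {H : Type*} [TopologicalSpace H]
  (I : ModelWithCorners ℝ (EuclideanSpace ℝ (Fin d)) H)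
  {M : Type*} [TopologicalSpace M] [ChartedSpace H M]

/-- In the chart around `x₀`, the tangent vector, at the point with coordinates `y`, whose
coordinates are `v`: that is `∑ i, v i • ∂ᵢ`, the image of `v` under the differential of the
inverse chart. -/
def coordVector (x₀ : M) (y v : EuclideanSpace ℝ (Fin d)) :
    TangentSpace I ((extChartAt I x₀).symm y) :=
  mfderivWithin 𝓘(ℝ, EuclideanSpace ℝ (Fin d)) I (extChartAt I x₀).symm (range I) y v

variable [RiemannianBundle (fun x : M ↦ TangentSpace I x)]

/-- The Gram matrix `g_ij = ⟪∂ᵢ, ∂ⱼ⟫` of the metric in the chart around `x₀`, at the point with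
coordinates `y`. -/
def gramMatrix (x₀ : M) (y : EuclideanSpace ℝ (Fin d)) : Matrix (Fin d) (Fin d) ℝ :=
  Matrix.of fun i j ↦ inner ℝ (coordVector I x₀ y (EuclideanSpace.single i 1))
    (coordVector I x₀ y (EuclideanSpace.single j 1))

/-- The Riemannian volume of the domain of the chart around `x₀`, as a measure on `M` that vanishes
outside this domain: the image under the inverse chart of `√(det g) dy`. -/
def chartVolume [MeasurableSpace M] (x₀ : M) : Measure M :=
  ((volume.restrict (extChartAt I x₀).target).withDensity
    fun y ↦ ENNReal.ofReal √(gramMatrix I x₀ y).det).map (extChartAt I x₀).symm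

variable (M) in
/-- The Riemannian volume measure. By the change of variables formula the chart volumes agree on
overlaps, and the volume measure, which restricts to each of them, is their supremum in the complete
lattice of measures. -/
def riemannianVolume [MeasurableSpace M] : Measure M :=
  ⨆ x₀ : M, chartVolume I x₀

/-- `G` is the gradient of `f` in the sense of distributions: in every chart, and for every
coordinate direction `v`, the function `⟪G, ∑ i, v i • ∂ᵢ⟫` is the weak derivative of `f` in the
direction `v` in the interior of the image of the chart. -/
def HasWeakGradient (f : M → ℝ) (G : ∀ x : M, TangentSpace I x) : Prop :=
  ∀ x₀ : M,
    LocallyIntegrableOn (fun y ↦ f ((extChartAt I x₀).symm y))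
      (interior (extChartAt I x₀).target) volume ∧
    ∀ v : EuclideanSpace ℝ (Fin d),
      LocallyIntegrableOn (fun y ↦ inner ℝ (G ((extChartAt I x₀).symm y)) (coordVector I x₀ y v))
        (interior (extChartAt I x₀).target) volume ∧
      ∀ η : EuclideanSpace ℝ (Fin d) → ℝ, ContDiff ℝ ∞ η → HasCompactSupport η →
        tsupport η ⊆ interior (extChartAt I x₀).target →
        ∫ y, f ((extChartAt I x₀).symm y) * fderiv ℝ η y v =
          -∫ y, inner ℝ (G ((extChartAt I x₀).symm y)) (coordVector I x₀ y v) * η y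

/-- `f` belongs to the Sobolev space `H^{1,2}(M, m)`, where `m` is the Riemannian volume, and `G` is
(a representative of) its weak gradient. -/
structure HasSobolevGradient [MeasurableSpace M] (f : M → ℝ) (G : ∀ x : M, TangentSpace I x) :
    Prop where
  memLp : MemLp f 2 (riemannianVolume I M)
  memLp_gradient : MemLp (fun x ↦ ‖G x‖) 2 (riemannianVolume I M)
  weakGradient : HasWeakGradient I f G

end Riemannian

/-- A function with weak gradient `G` is a weak solution of `Δ f = h` with homogeneous Neumann
boundary conditions if `-∫ ⟪∇φ, G⟫ dm = ∫ φ h dm` for all bounded Lipschitz functions `φ`. Here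
`⟪∇φ, G⟫` is the differential of `φ` applied to `G`; it exists almost everywhere. -/
def IsWeakNeumannGradient {d : ℕ} {H : Type*} [TopologicalSpace H]
    (I : ModelWithCorners ℝ (EuclideanSpace ℝ (Fin d)) H)
    {M : Type*} [MetricSpace M] [ChartedSpace H M]
    [RiemannianBundle (fun x : M ↦ TangentSpace I x)] [MeasurableSpace M]
    (G : ∀ x : M, TangentSpace I x) (h : M → ℝ) : Prop :=
  ∀ φ : M → ℝ, (∃ K, LipschitzWith K φ) → (∃ C : ℝ, ∀ x, |φ x| ≤ C) →
    -∫ x, (mfderiv I 𝓘(ℝ, ℝ) φ x (G x) : ℝ) ∂(riemannianVolume I M) =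
      ∫ x, φ x * h x ∂(riemannianVolume I M)

end

/-! The inequality is the Benamou-Brenier bound for one explicit curve, the linear interpolation
`u_t = (1 - t) u₀ + t u₁`. Since `∂_t u_t = u₁ - u₀ = Δ f`, it solves the continuity equation with
velocity `-∇f / u_t`, and its action is `∫∫ |∇f|² / u_t`. Averaging `1 / u_t` over `t` gives the
reciprocal of the logarithmic mean, which is the equality in the theorem.

No flow is constructed: the bound is proved by duality. Given bounded potentials with `ψ x + χ y ≤
d(x, y)²`, put `φ = -ψ / 2` and let `Q_t φ` be its Hopf-Lax evolution, so that `Q_t φ ≤ φ` and `Q_1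
φ ≥ χ / 2`. Formally `∂_t Q_t φ ≤ -|∇Q_t φ|² / 2`; with the weak equation tested against `Q_t φ`,
`d/dt ∫ Q_t φ u_t ≤ ∫ (-|∇Q_t φ|² u_t / 2 - ⟨∇Q_t φ, ∇f⟩) ≤ ½ ∫ |∇f|² / u_t`. Integrating in time
bounds `∫ ψ u₀ + ∫ χ u₁` by the action (`integral_potentials_le_action`).

This is made rigorous with finite increments. At each point one number `D`, the limit distance along
a minimizing sequence, controls both the time decay and the slope of `Q_t φ`
(`exists_hopfLax_bounds`). Completing the square in `D` eliminates it (`hopfLax_increment_le`), so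
neither a measurable choice of `D` nor a time derivative is needed. The resulting constant tends to
`1/2` under refinement (`ofReal_sub_le_half_lintegral`).

The duality itself (`wassersteinSq_le_of_forall_potentials`) needs only a separable metric space:
finite duality by Hahn-Banach, then tightness on `ℕ`, then partitions into small cells. -/

/-! ### Kantorovich duality: finite sets, countable sets, separable metric spaces -/

/-- **Kantorovich duality** for finitely supported marginals: either some transport plan has cost
at most `A`, or some admissible pair of potentials has value at least `A`. -/
theorem exists_plan_or_exists_potentials {ι κ : Type*} [Fintype ι] [Fintype κ]
    (p : ι → ℝ) (q : κ → ℝ) (hp : ∀ i, 0 ≤ p i) (hq : ∀ j, 0 ≤ q j) (hp1 : ∑ i, p i = 1)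
    (hq1 : ∑ j, q j = 1) (c : ι → κ → ℝ) (A : ℝ) :
    (∃ P : ι × κ → ℝ, (∀ z, 0 ≤ P z) ∧ (∀ i, ∑ j, P (i, j) = p i) ∧ (∀ j, ∑ i, P (i, j) = q j) ∧
      ∑ z, P z * c z.1 z.2 ≤ A) ∨
    ∃ (a : ι → ℝ) (b : κ → ℝ), (∀ i j, a i + b j ≤ c i j) ∧
      A ≤ ∑ i, a i * p i + ∑ j, b j * q j := by
  classical
  let L : (ι × κ → ℝ) →ₗ[ℝ] (ι → ℝ) × (κ → ℝ) × ℝ :=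
    { toFun := fun P ↦ (fun i ↦ ∑ j, P (i, j), fun j ↦ ∑ i, P (i, j), ∑ z, P z * c z.1 z.2)
      map_add' := fun P Q ↦ by
        ext <;> simp [Finset.sum_add_distrib, add_mul]
      map_smul' := fun r P ↦ by
        ext <;> simp [Finset.mul_sum, mul_assoc] }
  -- `L` records both marginals and the cost. A good plan exists iff the image of the simplex meets
  -- `T`; otherwise a separating functional supplies the potentials.
  let T : Set ((ι → ℝ) × (κ → ℝ) × ℝ) := {z | z.1 = p ∧ z.2.1 = q ∧ z.2.2 ≤ A}
  by_cases hdisj : Disjoint (L '' stdSimplex ℝ (ι × κ)) T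
  swap
  · left
    obtain ⟨z, ⟨P, hP, rfl⟩, h1, h2, h3⟩ := Set.not_disjoint_iff.1 hdisj
    exact ⟨P, hP.1, fun i ↦ congrFun h1 i, fun j ↦ congrFun h2 j, h3⟩
  right
  have hTc : IsClosed T :=
    (isClosed_eq continuous_fst continuous_const).inter
      ((isClosed_eq (continuous_fst.comp continuous_snd) continuous_const).inter
        (isClosed_le (continuous_snd.comp continuous_snd) continuous_const))
  have hTconv : Convex ℝ T := by
    rintro x ⟨hx1, hx2, hx3⟩ y ⟨hy1, hy2, hy3⟩ r s hr hs hrs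
    refine ⟨?_, ?_, ?_⟩
    · simp [hx1, hy1, ← add_smul, hrs]
    · simp [hx2, hy2, ← add_smul, hrs]
    · have h1 := mul_le_mul_of_nonneg_left hx3 hr
      have h2 := mul_le_mul_of_nonneg_left hy3 hs
      have : r * A + s * A = A := by rw [← add_mul, hrs, one_mul]
      simp only [Prod.snd_add, Prod.smul_snd, smul_eq_mul]
      linarith
  have hLcont : Continuous L := LinearMap.continuous_of_finiteDimensional L
  obtain ⟨f, u, v, hfu, huv, hfv⟩ := geometric_hahn_banach_compact_closed
    ((convex_stdSimplex ℝ (ι × κ)).linear_image L) ((isCompact_stdSimplex ℝ (ι × κ)).image hLcont)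
    hTconv hTc hdisj
  have hA : u < f (p, q, A) := huv.trans (hfv _ ⟨rfl, rfl, le_rfl⟩)
  set α : ι → ℝ := fun i ↦ f (Pi.single i 1, 0, 0) with hα
  set β : κ → ℝ := fun j ↦ f (0, Pi.single j 1, 0) with hβ
  set τ : ℝ := f (0, 0, 1) with hτ
  have hsingle (i : ι) : (fun j ↦ if i = j then (1 : ℝ) else 0) = Pi.single i 1 := by
    ext k; simp [Pi.single_apply, eq_comm]
  have hsingle' (i : κ) : (fun j ↦ if i = j then (1 : ℝ) else 0) = Pi.single i 1 := by
    ext k; simp [Pi.single_apply, eq_comm]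
  have hf (x : ι → ℝ) (y : κ → ℝ) (s : ℝ) :
      f (x, y, s) = ∑ i, x i * α i + ∑ j, y j * β j + s * τ := by
    have h1 : f (x, 0, 0) = ∑ i, x i * α i := by
      have := LinearMap.pi_apply_eq_sum_univ
        ((f : (ι → ℝ) × (κ → ℝ) × ℝ →ₗ[ℝ] ℝ) ∘ₗ LinearMap.inl ℝ (ι → ℝ) ((κ → ℝ) × ℝ)) x
      simp only [hsingle] at this
      simpa [hα] using! this
    have h2 : f (0, y, 0) = ∑ j, y j * β j := by
      have := LinearMap.pi_apply_eq_sum_univ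
        ((f : (ι → ℝ) × (κ → ℝ) × ℝ →ₗ[ℝ] ℝ) ∘ₗ LinearMap.inr ℝ (ι → ℝ) ((κ → ℝ) × ℝ) ∘ₗ
          LinearMap.inl ℝ (κ → ℝ) ℝ) y
      simp only [hsingle'] at this
      simpa [hβ] using! this
    have h3 : f (0, 0, s) = s * τ := by
      rw [hτ, ← smul_eq_mul, ← map_smul]; simp
    rw [← h1, ← h2, ← h3, ← map_add, ← map_add]; simp
  have hδ (i : ι) (j : κ) : α i + β j + c i j * τ < f (p, q, A) := by
    refine lt_of_eq_of_lt ?_ ((hfu _ ⟨Pi.single (i, j) 1, single_mem_stdSimplex ℝ _, rfl⟩).trans hA)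
    have : L (Pi.single (i, j) 1) = (Pi.single i 1, Pi.single j 1, c i j) := by
      ext k
      · by_cases hk : k = i <;> simp [L, Pi.single_apply, hk, -Finset.sum_boole]
      · by_cases hk : k = j <;> simp [L, Pi.single_apply, hk, -Finset.sum_boole]
      · simp [L, Pi.single_apply]
    rw [this, hf]
    simp [Pi.single_apply]
  have hprod : L (fun z ↦ p z.1 * q z.2) = (p, q, ∑ z : ι × κ, p z.1 * q z.2 * c z.1 z.2) := by
    ext k
    · simp [L, ← Finset.mul_sum, hq1]
    · simp [L, ← Finset.sum_mul, hp1]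
    · simp [L]
  set K := ∑ z : ι × κ, p z.1 * q z.2 * c z.1 z.2
  have hmem : (fun z : ι × κ ↦ p z.1 * q z.2) ∈ stdSimplex ℝ (ι × κ) := by
    refine ⟨fun z ↦ mul_nonneg (hp _) (hq _), ?_⟩
    rw [Fintype.sum_prod_type]
    simp [← Finset.mul_sum, hq1, hp1]
  have hK : A < K := by
    by_contra! hK
    exact Set.disjoint_left.1 hdisj ⟨_, hmem, hprod⟩ ⟨rfl, rfl, hK⟩
  -- The product plan has the right marginals and, by disjointness, cost `K > A`. Separation gives
  -- `f (p, q, K) < f (p, q, A)`, which forces the cost coefficient to be negative.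
  have hτ0 : τ < 0 := by
    have h := (hfu _ ⟨_, hmem, hprod⟩).trans hA
    rw [hf, hf] at h
    by_contra! h0
    have := mul_le_mul_of_nonneg_right hK.le h0
    linarith
  set S := ∑ i, p i * α i + ∑ j, q j * β j
  have hS : f (p, q, A) = S + A * τ := hf _ _ _
  -- Dividing by `-τ` normalizes the cost coefficient to `-1`; the constant added to the second
  -- potential makes the dual value exactly `A`.
  refine ⟨fun i ↦ α i / (-τ), fun j ↦ β j / (-τ) - S / (-τ) + A, fun i j ↦ ?_, ?_⟩
  · have h := hδ i j
    rw [hS] at h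
    have h0 : 0 < -τ := by linarith
    have : α i / -τ + (β j / -τ - S / -τ + A) = (α i + β j - S) / (-τ) + A := by ring
    rw [this, ← le_sub_iff_add_le, div_le_iff₀ h0]
    nlinarith
  · have e1 : ∑ i, α i / -τ * p i = (∑ i, p i * α i) / (-τ) := by
      rw [Finset.sum_div]; exact Finset.sum_congr rfl fun i _ ↦ by ring
    have e2 : ∑ j, (β j / -τ - S / -τ + A) * q j =
        (∑ j, q j * β j) / (-τ) + (-(S / -τ) + A) := by
      calc ∑ j, (β j / -τ - S / -τ + A) * q j
          = ∑ j, (q j * β j / (-τ) + q j * (-(S / -τ) + A)) :=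
            Finset.sum_congr rfl fun j _ ↦ by ring
        _ = _ := by rw [Finset.sum_add_distrib, ← Finset.sum_div, ← Finset.sum_mul, hq1, one_mul]
    rw [e1, e2]
    have : (∑ i, p i * α i) / -τ + (∑ j, q j * β j) / -τ = S / -τ := by rw [← add_div]
    linarith

/-- A transport plan between the images of two measures under a map with countably many values
lifts to a transport plan between the measures. -/
theorem exists_transportPlan_map_prodMap_eq {X ι : Type*} [MeasurableSpace X] [MeasurableSpace ι]
    [MeasurableSingletonClass ι] [Countable ι] {μ ν : Measure X} [IsProbabilityMeasure μ]
    [IsProbabilityMeasure ν] {i : X → ι} (hi : Measurable i) {Q : Measure (ι × ι)}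
    (hQ : Q ∈ transportPlans (μ.map i) (ν.map i)) :
    ∃ P ∈ transportPlans μ ν, P.map (Prod.map i i) = Q := by
  have hm (a : ι) : MeasurableSet (i ⁻¹' {a}) := hi (measurableSet_singleton a)
  -- Inside each pair of cells the mass `Q {z}` is spread as the product of the conditional
  -- measures. If a cell is null, `Q {z} = 0`, so the default value of `cond` does not matter.
  let P : Measure (X × X) := Measure.sum fun z : ι × ι ↦
    Q {z} • (ProbabilityTheory.cond μ (i ⁻¹' {z.1})).prod (ProbabilityTheory.cond ν (i ⁻¹' {z.2}))
  have h1 (z : ι × ι) (hz : Q {z} ≠ 0) : μ (i ⁻¹' {z.1}) ≠ 0 := by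
    intro h
    apply hz
    rw [← Measure.map_apply hi (measurableSet_singleton _), ← hQ.1,
      Measure.map_apply measurable_fst (measurableSet_singleton _)] at h
    exact measure_mono_null (by rintro _ rfl; rfl) h
  have h2 (z : ι × ι) (hz : Q {z} ≠ 0) : ν (i ⁻¹' {z.2}) ≠ 0 := by
    intro h
    apply hz
    rw [← Measure.map_apply hi (measurableSet_singleton _), ← hQ.2,
      Measure.map_apply measurable_snd (measurableSet_singleton _)] at h
    exact measure_mono_null (by rintro _ rfl; rfl) h
  have hcond (m : Measure X) [IsProbabilityMeasure m] :
      Measure.sum (fun a : ι ↦ m.map i {a} • ProbabilityTheory.cond m (i ⁻¹' {a})) = m := by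
    have : ∀ a : ι, m.map i {a} • ProbabilityTheory.cond m (i ⁻¹' {a}) = m.restrict (i ⁻¹' {a}) := by
      intro a
      rw [Measure.map_apply hi (measurableSet_singleton _), ProbabilityTheory.cond, smul_smul]
      by_cases h : m (i ⁻¹' {a}) = 0
      · simp [h, Measure.restrict_eq_zero.2 h]
      · rw [ENNReal.mul_inv_cancel h (measure_ne_top _ _), one_smul]
    simp_rw [this]
    rw [← Measure.restrict_iUnion (fun a b hab ↦ ?_) hm, ← preimage_iUnion, iUnion_of_singleton,
      preimage_univ, Measure.restrict_univ]
    exact Disjoint.preimage i (by simpa using hab)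
  have hdirac (m : Measure X) [IsProbabilityMeasure m] (a : ι) (ha : m (i ⁻¹' {a}) ≠ 0) :
      (ProbabilityTheory.cond m (i ⁻¹' {a})).map i = Measure.dirac a := by
    have := ProbabilityTheory.cond_isProbabilityMeasure ha
    have hae : i =ᵐ[ProbabilityTheory.cond m (i ⁻¹' {a})] fun _ ↦ a :=
      ProbabilityTheory.ae_cond_mem (hm a)
    rw [Measure.map_congr hae, Measure.map_const]
    simp
  refine ⟨P, ⟨?_, ?_⟩, ?_⟩
  · rw [Measure.map_sum measurable_fst.aemeasurable]
    ext s hs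
    conv_rhs => rw [← hcond μ]
    rw [Measure.sum_apply _ hs, Measure.sum_apply _ hs]
    simp only [Measure.smul_apply, smul_eq_mul, Measure.map_smul]
    calc ∑' z : ι × ι, Q {z} * _
        = ∑' z : ι × ι, ProbabilityTheory.cond μ (i ⁻¹' {z.1}) s * Q {z} := by
          refine tsum_congr fun z ↦ ?_
          by_cases hz : Q {z} = 0
          · simp [hz]
          have := ProbabilityTheory.cond_isProbabilityMeasure (h2 z hz)
          rw [Measure.map_fst_prod, measure_univ, one_smul, mul_comm]
      _ = ∫⁻ z, ProbabilityTheory.cond μ (i ⁻¹' {z.1}) s ∂Q := (lintegral_countable' _).symm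
      _ = ∫⁻ a, ProbabilityTheory.cond μ (i ⁻¹' {a}) s ∂(Q.map Prod.fst) :=
          (lintegral_map (f := fun a ↦ ProbabilityTheory.cond μ (i ⁻¹' {a}) s)
            (measurable_of_countable _) measurable_fst).symm
      _ = _ := by
          rw [hQ.1, lintegral_countable']
          exact tsum_congr fun a ↦ mul_comm _ _
  · rw [Measure.map_sum measurable_snd.aemeasurable]
    ext s hs
    conv_rhs => rw [← hcond ν]
    rw [Measure.sum_apply _ hs, Measure.sum_apply _ hs]
    simp only [Measure.smul_apply, smul_eq_mul, Measure.map_smul]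
    calc ∑' z : ι × ι, Q {z} * _
        = ∑' z : ι × ι, ProbabilityTheory.cond ν (i ⁻¹' {z.2}) s * Q {z} := by
          refine tsum_congr fun z ↦ ?_
          by_cases hz : Q {z} = 0
          · simp [hz]
          have := ProbabilityTheory.cond_isProbabilityMeasure (h1 z hz)
          rw [Measure.map_snd_prod, measure_univ, one_smul, mul_comm]
      _ = ∫⁻ z, ProbabilityTheory.cond ν (i ⁻¹' {z.2}) s ∂Q := (lintegral_countable' _).symm
      _ = ∫⁻ a, ProbabilityTheory.cond ν (i ⁻¹' {a}) s ∂(Q.map Prod.snd) :=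
          (lintegral_map (f := fun a ↦ ProbabilityTheory.cond ν (i ⁻¹' {a}) s)
            (measurable_of_countable _) measurable_snd).symm
      _ = _ := by
          rw [hQ.2, lintegral_countable']
          exact tsum_congr fun a ↦ mul_comm _ _
  · rw [Measure.map_sum (hi.prodMap hi).aemeasurable]
    conv_rhs => rw [← Measure.sum_smul_dirac Q]
    congr 1
    ext1 z
    by_cases hz : Q {z} = 0
    · simp [hz]
    rw [Measure.map_smul, ← Measure.map_prod_map _ _ hi hi, hdirac μ _ (h1 z hz),
      hdirac ν _ (h2 z hz), Measure.dirac_prod_dirac]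

/-- Kantorovich duality for probability measures on a finite type. -/
theorem exists_transportPlan_or_exists_potentials {ι : Type*} [Fintype ι] [MeasurableSpace ι]
    [MeasurableSingletonClass ι] (μ ν : Measure ι) [IsProbabilityMeasure μ] [IsProbabilityMeasure ν]
    (c : ι → ι → ℝ) (hc : ∀ i j, 0 ≤ c i j) (A : ℝ) :
    (∃ Q ∈ transportPlans μ ν, ∫⁻ z, ENNReal.ofReal (c z.1 z.2) ∂Q ≤ ENNReal.ofReal A) ∨
    ∃ a b : ι → ℝ, (∀ i j, a i + b j ≤ c i j) ∧ A ≤ ∫ i, a i ∂μ + ∫ j, b j ∂ν := by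
  have hone (m : Measure ι) [IsProbabilityMeasure m] : ∑ i, m.real {i} = 1 := by
    simp
  rcases exists_plan_or_exists_potentials (fun i ↦ μ.real {i}) (fun j ↦ ν.real {j})
    (fun i ↦ measureReal_nonneg) (fun j ↦ measureReal_nonneg) (hone μ) (hone ν) c A with
    ⟨P, hP0, hP1, hP2, hPc⟩ | ⟨a, b, hab, hA⟩
  · left
    let Q : Measure (ι × ι) := Measure.sum fun z ↦ ENNReal.ofReal (P z) • Measure.dirac z
    have hQl (g : ι × ι → ℝ≥0∞) : ∫⁻ z, g z ∂Q = ∑ z, ENNReal.ofReal (P z) * g z := by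
      simp [Q]
    have hμ (m : Measure ι) [IsProbabilityMeasure m] (s : Set ι) :
        m s = ∑ i, ENNReal.ofReal (m.real {i}) * s.indicator 1 i := by
      rw [← lintegral_indicator_one (Set.toFinite s).measurableSet, lintegral_fintype]
      exact Finset.sum_congr rfl fun i _ ↦ by rw [ofReal_measureReal, mul_comm]
    refine ⟨Q, ⟨?_, ?_⟩, ?_⟩
    · ext s hs
      rw [← lintegral_indicator_one hs, lintegral_map (measurable_of_countable _) measurable_fst,
        hQl, hμ μ, Fintype.sum_prod_type]
      refine Finset.sum_congr rfl fun i _ ↦ ?_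
      rw [← hP1 i, ENNReal.ofReal_sum_of_nonneg fun j _ ↦ hP0 _, Finset.sum_mul]
    · ext s hs
      rw [← lintegral_indicator_one hs, lintegral_map (measurable_of_countable _) measurable_snd,
        hQl, hμ ν, Fintype.sum_prod_type_right]
      refine Finset.sum_congr rfl fun i _ ↦ ?_
      rw [← hP2 i, ENNReal.ofReal_sum_of_nonneg fun j _ ↦ hP0 _, Finset.sum_mul]
    · rw [hQl]
      simp_rw [← ENNReal.ofReal_mul (hP0 _)]
      rw [← ENNReal.ofReal_sum_of_nonneg fun z _ ↦ mul_nonneg (hP0 _) (hc _ _)]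
      exact ENNReal.ofReal_le_ofReal hPc
  · right
    refine ⟨a, b, hab, hA.trans_eq ?_⟩
    rw [integral_fintype Integrable.of_finite, integral_fintype Integrable.of_finite]
    simp [mul_comm]

/-- A sequence of transport plans between two probability measures on `ℕ` whose truncated costs are
bounded has a limit whose full cost satisfies the same bound. -/
theorem exists_transportPlan_nat_lintegral_le {μ ν : Measure ℕ} [IsProbabilityMeasure μ]
    [IsProbabilityMeasure ν] (c : ℕ → ℕ → NNReal) (A : ℝ≥0∞) (Q : ℕ → Measure (ℕ × ℕ))
    (hQ : ∀ n, Q n ∈ transportPlans μ ν)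
    (hA : ∀ n, ∫⁻ z, (if z.1 < n ∧ z.2 < n then (c z.1 z.2 : ℝ≥0∞) else 0) ∂(Q n) ≤ A) :
    ∃ P ∈ transportPlans μ ν, ∫⁻ z, (c z.1 z.2 : ℝ≥0∞) ∂P ≤ A := by
  have hQp (n : ℕ) : IsProbabilityMeasure (Q n) := by
    have h : IsProbabilityMeasure ((Q n).map Prod.fst) := by rw [(hQ n).1]; infer_instance
    exact (Measure.isProbabilityMeasure_map_iff measurable_fst.aemeasurable).1 h
  let Q' (n : ℕ) : ProbabilityMeasure (ℕ × ℕ) := ⟨Q n, hQp n⟩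
  let u (n : ℕ) : NNReal := (μ (Ici n)).toNNReal + (ν (Ici n)).toNNReal
  have hlim (m : Measure ℕ) [IsProbabilityMeasure m] :
      Filter.Tendsto (fun n ↦ (m (Ici n)).toNNReal) Filter.atTop (nhds 0) := by
    have : Filter.Tendsto (fun n ↦ m (Ici n)) Filter.atTop (nhds 0) := by
      have h0 : ⋂ n : ℕ, Ici n = (∅ : Set ℕ) := by
        ext k; simpa using ⟨k + 1, by omega⟩
      have := tendsto_measure_iInter_atTop (μ := m) (s := fun n : ℕ ↦ Ici n)
        (fun n ↦ measurableSet_Ici.nullMeasurableSet) (fun a b hab ↦ Ici_subset_Ici.2 hab)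
        ⟨0, measure_ne_top _ _⟩
      simpa [h0] using! this
    simpa using! (ENNReal.tendsto_toNNReal ENNReal.zero_ne_top).comp this
  -- Tightness: the mass of a plan outside a square is at most the sum of the tails of its
  -- marginals, uniformly over all plans. A free ultrafilter then selects the limit.
  have hcomp : IsCompact {P : ProbabilityMeasure (ℕ × ℕ) | ∀ n, P (Iio n ×ˢ Iio n)ᶜ ≤ u n} :=
    isCompact_setOfPred_probabilityMeasure_mass_eq_compl_isCompact_le
      (by simpa [u] using (hlim μ).add (hlim ν))
      (fun n ↦ ((finite_Iio n).prod (finite_Iio n)).isCompact)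
      (Or.inr fun a b hab ↦ prod_mono (Iio_subset_Iio hab) (Iio_subset_Iio hab))
  have hmem (k : ℕ) : Q' k ∈ {P : ProbabilityMeasure (ℕ × ℕ) | ∀ n, P (Iio n ×ˢ Iio n)ᶜ ≤ u n} := by
    intro n
    have h : (Q k) (Iio n ×ˢ Iio n)ᶜ ≤ μ (Ici n) + ν (Ici n) := by
      rw [← (hQ k).1, ← (hQ k).2, Measure.map_apply measurable_fst measurableSet_Ici,
        Measure.map_apply measurable_snd measurableSet_Ici]
      refine (measure_mono ?_).trans (measure_union_le _ _)
      intro z hz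
      simp only [mem_compl_iff, mem_prod, mem_Iio, not_and_or, not_lt] at hz
      exact hz
    have := ENNReal.toNNReal_mono (by finiteness) h
    rwa [ENNReal.toNNReal_add (by finiteness) (by finiteness)] at this
  obtain ⟨P, -, hP⟩ := hcomp.ultrafilter_le_nhds ((Filter.hyperfilter ℕ : Ultrafilter ℕ).map Q')
    (by
      rw [Filter.le_principal_iff]
      exact Filter.mem_map.2 (Filter.univ_mem' hmem))
  have hP : Filter.Tendsto Q' (Filter.hyperfilter ℕ) (nhds P) := hP
  have hmap (g : ℕ × ℕ → ℕ) (hg : Continuous g) (m : Measure ℕ) [hm : IsProbabilityMeasure m]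
      (h : ∀ n, (Q n).map g = m) : (P : Measure (ℕ × ℕ)).map g = m := by
    have h1 := ProbabilityMeasure.tendsto_map_of_tendsto_of_continuous Q' P hP hg
    have h2 : ∀ n, (Q' n).map hg.measurable.aemeasurable = (⟨m, hm⟩ : ProbabilityMeasure ℕ) :=
      fun n ↦ Subtype.ext (h n)
    simp_rw [h2] at h1
    exact congrArg ProbabilityMeasure.toMeasure (tendsto_nhds_unique h1 tendsto_const_nhds)
  refine ⟨P, ⟨hmap _ continuous_fst μ fun n ↦ (hQ n).1, hmap _ continuous_snd ν fun n ↦ (hQ n).2⟩,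
    ?_⟩
  -- Each truncated cost is bounded, and continuous because the space is discrete, so its bound
  -- passes to the weak limit; monotone convergence in `k` then recovers the full cost.
  let g (k : ℕ) (z : ℕ × ℕ) : NNReal := if z.1 < k ∧ z.2 < k then c z.1 z.2 else 0
  have hg (k : ℕ) : ∃ C, ∀ z, g k z ≤ C := by
    refine ⟨∑ i ∈ Finset.range k, ∑ j ∈ Finset.range k, c i j, fun z ↦ ?_⟩
    by_cases hz : z.1 < k ∧ z.2 < k
    · simp only [g, hz, and_self, if_true]
      exact (Finset.single_le_sum (f := fun j ↦ c z.1 j) (fun _ _ ↦ zero_le)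
        (Finset.mem_range.2 hz.2)).trans
        (Finset.single_le_sum (f := fun i ↦ ∑ j ∈ Finset.range k, c i j) (fun _ _ ↦ zero_le)
        (Finset.mem_range.2 hz.1))
    · simp [g, hz]
  have hgA (k : ℕ) : ∫⁻ z, (g k z : ℝ≥0∞) ∂P ≤ A := by
    obtain ⟨C, hC⟩ := hg k
    let G : BoundedContinuousFunction (ℕ × ℕ) NNReal :=
      BoundedContinuousFunction.mkOfBound ⟨g k, continuous_of_discreteTopology⟩ C fun x y ↦ by
        rw [NNReal.dist_eq]
        have h1 : (g k x : ℝ) ≤ C := hC x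
        have h2 : (g k y : ℝ) ≤ C := hC y
        have h3 : 0 ≤ (g k x : ℝ) := (g k x).2
        have h4 : 0 ≤ (g k y : ℝ) := (g k y).2
        exact abs_le.2 ⟨by simp only [ContinuousMap.coe_mk]; linarith,
          by simp only [ContinuousMap.coe_mk]; linarith⟩
    have hG := (ProbabilityMeasure.tendsto_iff_forall_lintegral_tendsto.1 hP) G
    refine le_of_tendsto hG (Filter.Eventually.filter_mono
      (Nat.cofinite_eq_atTop ▸ Filter.hyperfilter_le_cofinite) ?_)
    filter_upwards [Filter.eventually_ge_atTop k] with n hn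
    refine le_trans (lintegral_mono fun z ↦ ?_) (hA n)
    change (g k z : ℝ≥0∞) ≤ _
    by_cases hz : z.1 < k ∧ z.2 < k
    · simp [g, hz, hz.1.trans_le hn, hz.2.trans_le hn]
    · simp [g, hz]
  have hmono : Monotone fun k (z : ℕ × ℕ) ↦ (g k z : ℝ≥0∞) := by
    intro a b hab z
    by_cases hz : z.1 < a ∧ z.2 < a
    · simp [g, hz, hz.1.trans_le hab, hz.2.trans_le hab]
    · simp [g, hz]
  calc ∫⁻ z : ℕ × ℕ, (c z.1 z.2 : ℝ≥0∞) ∂P ≤ ∫⁻ z, ⨆ k, (g k z : ℝ≥0∞) ∂P := by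
        refine lintegral_mono fun (z : ℕ × ℕ) ↦ le_trans ?_ (le_iSup (fun k ↦ (g k z : ℝ≥0∞)) (z.1 + z.2 + 1))
        simp [g, show z.1 ≤ z.1 + z.2 by omega, show z.2 ≤ z.1 + z.2 by omega]
    _ = ⨆ k, ∫⁻ z, (g k z : ℝ≥0∞) ∂P :=
        lintegral_iSup (fun k ↦ measurable_of_countable _) hmono
    _ ≤ A := iSup_le hgA

/-- A separable metric space can be partitioned into countably many measurable cells of small
diameter. -/
theorem exists_measurable_nat_dist_le {X : Type*} [PseudoMetricSpace X] [Nonempty X]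
    [TopologicalSpace.SeparableSpace X] [MeasurableSpace X] [OpensMeasurableSpace X] {ε : ℝ}
    (hε : 0 < ε) : ∃ i : X → ℕ, Measurable i ∧ ∀ x y, i x = i y → dist x y ≤ ε := by
  classical
  have h (x : X) : ∃ n, dist x (TopologicalSpace.denseSeq X n) < ε / 2 := by
    exact (TopologicalSpace.denseRange_denseSeq X).exists_dist_lt x (half_pos hε)
  refine ⟨fun x ↦ Nat.find (h x), measurable_find h fun k ↦ ?_, fun x y hxy ↦ ?_⟩
  · exact (isOpen_lt (by fun_prop) continuous_const).measurableSet
  · have h1 := Nat.find_spec (h x)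
    have h2 := Nat.find_spec (h y)
    simp only at hxy
    rw [← hxy] at h2
    have := dist_triangle_right x y (TopologicalSpace.denseSeq X (Nat.find (h x)))
    linarith

/-- The quadratic transport cost of two families of potentials on the cells of a partition can be
realized on the space. -/
theorem exists_transportPlan_nat_of_dual {X : Type*} [MeasurableSpace X] {μ ν : Measure X}
    [IsProbabilityMeasure μ] [IsProbabilityMeasure ν] {i : X → ℕ} (hi : Measurable i)
    (c : ℕ → ℕ → ℝ) (hc : ∀ k l, 0 ≤ c k l) {A R : ℝ} (hRA : R < A)
    (h : ∀ a b : ℕ → ℝ, (∃ C, ∀ k, |a k| ≤ C) → (∃ C, ∀ k, |b k| ≤ C) →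
      (∀ k l, a k + b l ≤ c k l) → ∫ x, a (i x) ∂μ + ∫ y, b (i y) ∂ν ≤ R) :
    ∃ Q ∈ transportPlans (μ.map i) (ν.map i),
      ∫⁻ z, ENNReal.ofReal (c z.1 z.2) ∂Q ≤ ENNReal.ofReal A := by
  have hiμ : IsProbabilityMeasure (μ.map i) := Measure.isProbabilityMeasure_map hi.aemeasurable
  have hiν : IsProbabilityMeasure (ν.map i) := Measure.isProbabilityMeasure_map hi.aemeasurable
  have key (N : ℕ) : ∃ Q ∈ transportPlans (μ.map i) (ν.map i),
      ∫⁻ z, (if z.1 < N ∧ z.2 < N then ((c z.1 z.2).toNNReal : ℝ≥0∞) else 0) ∂Q ≤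
        ENNReal.ofReal A := by
    -- All indices from `N` on collapse to one point, at which the cost is set to zero. The
    -- truncated cost lies below `c`, so its dual potentials pull back to admissible ones, and a
    -- dual value `A > R` is impossible.
    let r : ℕ → Fin (N + 1) := fun k ↦ ⟨min k N, by omega⟩
    have hr : Measurable r := measurable_of_countable _
    have := Measure.isProbabilityMeasure_map (μ := μ.map i) hr.aemeasurable
    have := Measure.isProbabilityMeasure_map (μ := ν.map i) hr.aemeasurable
    let cN (k l : Fin (N + 1)) : ℝ := if (k : ℕ) < N ∧ (l : ℕ) < N then c k l else 0
    have hcN (k l : ℕ) : cN (r k) (r l) = if k < N ∧ l < N then c k l else 0 := by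
      by_cases hkl : k < N ∧ l < N
      · have h1 : min k N = k := by omega
        have h2 : min l N = l := by omega
        simp only [cN, r, h1, h2]
      · have : ¬ (min k N < N ∧ min l N < N) := by omega
        simp only [cN, r, this, hkl, if_false]
    rcases exists_transportPlan_or_exists_potentials ((μ.map i).map r) ((ν.map i).map r) cN
      (fun k l ↦ by simp only [cN]; split_ifs <;> simp [hc]) A with ⟨Q', hQ', hQA⟩ | ⟨a, b, hab, hA⟩
    · obtain ⟨Q, hQ, rfl⟩ := exists_transportPlan_map_prodMap_eq hr hQ'
      refine ⟨Q, hQ, ?_⟩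
      rw [lintegral_map (measurable_of_countable _) (hr.prodMap hr)] at hQA
      refine le_trans (le_of_eq (lintegral_congr fun z ↦ ?_)) hQA
      simp only [Prod.map_fst, Prod.map_snd, hcN]
      split_ifs
      · rfl
      · simp
    · exfalso
      have hb (g : Fin (N + 1) → ℝ) : ∃ C, ∀ k, |g (r k)| ≤ C := by
        refine ⟨∑ m, |g m|, fun k ↦ ?_⟩
        exact Finset.single_le_sum (f := fun m ↦ |g m|) (fun _ _ ↦ abs_nonneg _)
          (Finset.mem_univ (r k))
      have := h (fun k ↦ a (r k)) (fun k ↦ b (r k)) (hb a) (hb b) fun k l ↦ by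
        refine (hab _ _).trans ?_
        rw [hcN]
        split_ifs
        · exact le_rfl
        · exact hc k l
      rw [integral_map hr.aemeasurable (measurable_of_countable _).aestronglyMeasurable,
        integral_map hr.aemeasurable (measurable_of_countable _).aestronglyMeasurable,
        integral_map hi.aemeasurable (measurable_of_countable _).aestronglyMeasurable,
        integral_map hi.aemeasurable (measurable_of_countable _).aestronglyMeasurable] at hA
      linarith
  choose Q hQ hQA using key
  exact exists_transportPlan_nat_lintegral_le (fun k l ↦ (c k l).toNNReal) _ Q hQ hQA

/-- **Kantorovich duality** for the quadratic cost on a separable metric space, as an upper bound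
for the Wasserstein distance. -/
theorem wassersteinSq_le_of_forall_potentials {X : Type*} [PseudoMetricSpace X]
    [TopologicalSpace.SeparableSpace X] [MeasurableSpace X] [OpensMeasurableSpace X]
    {μ ν : Measure X} [IsProbabilityMeasure μ] [IsProbabilityMeasure ν] {R : ℝ} (hR : 0 ≤ R)
    (h : ∀ ψ χ : X → ℝ, Measurable ψ → Measurable χ → (∃ C, ∀ x, |ψ x| ≤ C) →
      (∃ C, ∀ x, |χ x| ≤ C) → (∀ x y, ψ x + χ y ≤ dist x y ^ 2) →
      ∫ x, ψ x ∂μ + ∫ y, χ y ∂ν ≤ R) :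
    wassersteinSq μ ν ≤ ENNReal.ofReal R := by
  have : Nonempty X := μ.nonempty_of_neZero
  have key {ε : ℝ} (hε : 0 < ε) :
      wassersteinSq μ ν ≤ ENNReal.ofReal ((1 + ε) * (R + ε) + (4 * ε ^ 2 + 4 * ε)) := by
    obtain ⟨i, hi, hdi⟩ := exists_measurable_nat_dist_le (X := X) hε
    obtain ⟨c, hc, hcle, hlec⟩ : ∃ c : ℕ → ℕ → ℝ, (∀ k l, 0 ≤ c k l) ∧
        (∀ x y, c (i x) (i y) ≤ dist x y ^ 2) ∧
        ∀ x y, dist x y ^ 2 ≤ (1 + ε) * c (i x) (i y) + (4 * ε ^ 2 + 4 * ε) := by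
      -- Taking the infimum over cells makes potentials on cells admissible on the space. Since
      -- cells have diameter at most `ε`, little is lost. For an empty cell the default `sInf ∅ = 0`
      -- keeps `c` nonnegative.
      let c (k l : ℕ) : ℝ := sInf ((fun z : X × X ↦ dist z.1 z.2 ^ 2) '' {z | i z.1 = k ∧ i z.2 = l})
      have hc (k l : ℕ) : 0 ≤ c k l := Real.sInf_nonneg (by rintro _ ⟨z, -, rfl⟩; positivity)
      have hcle (x y : X) : c (i x) (i y) ≤ dist x y ^ 2 :=
        csInf_le ⟨0, by rintro _ ⟨z, -, rfl⟩; positivity⟩ ⟨(x, y), ⟨rfl, rfl⟩, rfl⟩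
      refine ⟨c, hc, hcle, fun x y ↦ ?_⟩
      set s := max 0 (dist x y - 2 * ε)
      have hs : s ^ 2 ≤ c (i x) (i y) := by
        refine le_csInf ⟨_, (x, y), ⟨rfl, rfl⟩, rfl⟩ ?_
        rintro _ ⟨⟨x', y'⟩, ⟨hx, hy⟩, rfl⟩
        refine pow_le_pow_left₀ (le_max_left _ _) (max_le dist_nonneg ?_) 2
        have h1 := dist_triangle4 x x' y' y
        have h2 := hdi _ _ hx
        have h3 := hdi _ _ hy
        rw [dist_comm x' x] at h2
        simp only at h1 h2 h3 ⊢
        linarith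
      have h1 : dist x y ≤ s + 2 * ε := by linarith [le_max_right 0 (dist x y - 2 * ε)]
      have h0 : 0 ≤ s := le_max_left _ _
      calc dist x y ^ 2 ≤ (s + 2 * ε) ^ 2 := pow_le_pow_left₀ dist_nonneg h1 2
        -- The cross term `4 ε s` is absorbed by `ε (s - 2)² ≥ 0`.
        _ ≤ (1 + ε) * s ^ 2 + (4 * ε ^ 2 + 4 * ε) := by nlinarith [mul_nonneg hε.le (sq_nonneg (s - 2))]
          _ ≤ _ := by gcongr
    obtain ⟨Q, hQ, hQR⟩ := exists_transportPlan_nat_of_dual (μ := μ) (ν := ν) hi c hc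
      (lt_add_of_pos_right R hε) fun a b ⟨Ca, ha⟩ ⟨Cb, hb⟩ hab ↦
        h (a ∘ i) (b ∘ i) ((measurable_of_countable a).comp hi) ((measurable_of_countable b).comp hi)
          ⟨Ca, fun x ↦ ha _⟩ ⟨Cb, fun x ↦ hb _⟩ fun x y ↦ (hab _ _).trans (hcle x y)
    obtain ⟨P, hP, rfl⟩ := exists_transportPlan_map_prodMap_eq hi hQ
    have hPp : IsProbabilityMeasure P := by
      have h : IsProbabilityMeasure (P.map Prod.fst) := by rw [hP.1]; infer_instance
      exact (Measure.isProbabilityMeasure_map_iff measurable_fst.aemeasurable).1 h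
    refine (iInf₂_le P hP).trans ?_
    rw [lintegral_map (measurable_of_countable _) (hi.prodMap hi)] at hQR
    have hm : Measurable fun z : X × X ↦ ENNReal.ofReal (c (i z.1) (i z.2)) :=
      (measurable_of_countable fun z : ℕ × ℕ ↦ ENNReal.ofReal (c z.1 z.2)).comp (hi.prodMap hi)
    calc ∫⁻ z, edist z.1 z.2 ^ 2 ∂P
        ≤ ∫⁻ z, (ENNReal.ofReal (1 + ε) * ENNReal.ofReal (c (i z.1) (i z.2)) +
            ENNReal.ofReal (4 * ε ^ 2 + 4 * ε)) ∂P := by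
          refine lintegral_mono fun z ↦ ?_
          rw [edist_dist, ← ENNReal.ofReal_pow dist_nonneg, ← ENNReal.ofReal_mul (by positivity),
            ← ENNReal.ofReal_add (mul_nonneg (by positivity) (hc _ _)) (by positivity)]
          exact ENNReal.ofReal_le_ofReal (hlec _ _)
      _ = ENNReal.ofReal (1 + ε) * ∫⁻ z, ENNReal.ofReal (c (i z.1) (i z.2)) ∂P +
            ENNReal.ofReal (4 * ε ^ 2 + 4 * ε) := by
          rw [lintegral_add_right _ measurable_const, lintegral_const_mul _ hm, lintegral_const,
            measure_univ, mul_one]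
      _ ≤ ENNReal.ofReal (1 + ε) * ENNReal.ofReal (R + ε) +
            ENNReal.ofReal (4 * ε ^ 2 + 4 * ε) := by gcongr; exact hQR
      _ = _ := by
          rw [← ENNReal.ofReal_mul (by positivity), ← ENNReal.ofReal_add (by positivity)
            (by positivity)]
  have hlim : Filter.Tendsto
      (fun ε : ℝ ↦ ENNReal.ofReal ((1 + ε) * (R + ε) + (4 * ε ^ 2 + 4 * ε)))
      (nhdsWithin 0 (Ioi 0)) (nhds (ENNReal.ofReal R)) := by
    have : Continuous fun ε : ℝ ↦ ENNReal.ofReal ((1 + ε) * (R + ε) + (4 * ε ^ 2 + 4 * ε)) :=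
      ENNReal.continuous_ofReal.comp (by fun_prop)
    have := this.tendsto 0
    simp only [add_zero, one_mul, mul_zero, ne_eq, OfNat.ofNat_ne_zero, not_false_eq_true,
      zero_pow] at this
    exact this.mono_left nhdsWithin_le_nhds
  exact ge_of_tendsto hlim (eventually_nhdsWithin_of_forall fun ε hε ↦ key hε)

/-! ### The Hopf-Lax semigroup -/

/-- The Hopf-Lax semigroup of a function on a metric space. -/
noncomputable def hopfLax {X : Type*} [PseudoMetricSpace X] (φ : X → ℝ) (t : ℝ) (x : X) : ℝ :=
  ⨅ y, (φ y + dist x y ^ 2 / (2 * t))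

section HopfLax

variable {X : Type*} [PseudoMetricSpace X] {φ : X → ℝ} {C t : ℝ}

theorem hopfLax_le (hφ : ∀ x, |φ x| ≤ C) (ht : 0 < t) (x y : X) :
    hopfLax φ t x ≤ φ y + dist x y ^ 2 / (2 * t) := by
  refine ciInf_le ⟨-C, ?_⟩ y
  rintro _ ⟨z, rfl⟩
  have h1 := (abs_le.1 (hφ z)).1
  have h2 : 0 ≤ dist x z ^ 2 / (2 * t) := by positivity
  simp only
  linarith

theorem hopfLax_le_self (hφ : ∀ x, |φ x| ≤ C) (ht : 0 < t) (x : X) : hopfLax φ t x ≤ φ x := by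
  simpa using hopfLax_le hφ ht x x

theorem abs_hopfLax_le (hφ : ∀ x, |φ x| ≤ C) (ht : 0 < t) (x : X) : |hopfLax φ t x| ≤ C := by
  have : Nonempty X := ⟨x⟩
  refine abs_le.2 ⟨le_ciInf fun y ↦ ?_, (hopfLax_le_self hφ ht x).trans (abs_le.1 (hφ x)).2⟩
  have h1 := (abs_le.1 (hφ y)).1
  have h2 : 0 ≤ dist x y ^ 2 / (2 * t) := by positivity
  linarith

/-- The limit distance `D` of a minimizing sequence controls both the decay in time and the growth
in space of the Hopf-Lax semigroup. -/
theorem exists_hopfLax_bounds (hφ : ∀ x, |φ x| ≤ C) (ht : 0 < t) (x : X) :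
    ∃ D : ℝ, 0 ≤ D ∧ D ^ 2 ≤ 4 * t * C ∧
      (∀ s, 0 < s → hopfLax φ s x ≤ hopfLax φ t x + (D ^ 2 / (2 * s) - D ^ 2 / (2 * t))) ∧
      ∀ x', hopfLax φ t x' ≤ hopfLax φ t x + dist x' x * (2 * D + dist x' x) / (2 * t) := by
  have : Nonempty X := ⟨x⟩
  have hy (n : ℕ) : ∃ y, φ y + dist x y ^ 2 / (2 * t) < hopfLax φ t x + 1 / ((n : ℝ) + 1) :=
    exists_lt_of_ciInf_lt (lt_add_of_pos_right _ Nat.one_div_pos_of_nat)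
  choose y hy using hy
  have hC := abs_hopfLax_le hφ ht x
  have hdn (n : ℕ) : dist x (y n) ^ 2 ≤ 4 * t * C + 2 * t * (1 / ((n : ℝ) + 1)) := by
    have h1 := hy n
    have h2 := (abs_le.1 (hφ (y n))).1
    have h3 := (abs_le.1 hC).2
    have h4 : dist x (y n) ^ 2 / (2 * t) ≤ 2 * C + 1 / ((n : ℝ) + 1) := by linarith
    rw [div_le_iff₀ (by positivity)] at h4
    linarith
  have hmem (n : ℕ) : dist x (y n) ∈ Icc 0 (√(4 * t * C + 2 * t)) := by
    refine ⟨dist_nonneg, Real.le_sqrt_of_sq_le ((hdn n).trans ?_)⟩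
    have : 1 / ((n : ℝ) + 1) ≤ 1 := by
      rw [div_le_one (by positivity)]; linarith [n.cast_nonneg (α := ℝ)]
    nlinarith
  -- No minimizer need exist, as balls may fail to be compact; only the distances to the minimizing
  -- sequence converge, along a subsequence.
  obtain ⟨D, hD, u, hu, hlim⟩ := isCompact_Icc.tendsto_subseq hmem
  have h0 : Filter.Tendsto (fun n ↦ 1 / ((u n : ℝ) + 1)) Filter.atTop (nhds 0) :=
    tendsto_one_div_add_atTop_nhds_zero_nat.comp hu.tendsto_atTop
  have hlim' : Filter.Tendsto (fun n ↦ dist x (y (u n))) Filter.atTop (nhds D) := hlim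
  refine ⟨D, hD.1, ?_, fun s hs ↦ ?_, fun x' ↦ ?_⟩
  · have h1 : Filter.Tendsto (fun n ↦ 4 * t * C + 2 * t * (1 / ((u n : ℝ) + 1))) Filter.atTop
        (nhds (4 * t * C + 2 * t * 0)) := (h0.const_mul _).const_add _
    rw [mul_zero, add_zero] at h1
    exact le_of_tendsto_of_tendsto' (hlim'.pow 2) h1 fun n ↦ hdn _
  · have h1 : Filter.Tendsto (fun n ↦ hopfLax φ t x + 1 / ((u n : ℝ) + 1) +
        (dist x (y (u n)) ^ 2 / (2 * s) - dist x (y (u n)) ^ 2 / (2 * t))) Filter.atTop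
        (nhds (hopfLax φ t x + 0 + (D ^ 2 / (2 * s) - D ^ 2 / (2 * t)))) :=
      (h0.const_add _).add (((hlim'.pow 2).div_const _).sub ((hlim'.pow 2).div_const _))
    rw [add_zero] at h1
    refine ge_of_tendsto' h1 fun n ↦ ?_
    have := hopfLax_le hφ hs x (y (u n))
    linarith [hy (u n)]
  · have h1 : Filter.Tendsto (fun n ↦ hopfLax φ t x + 1 / ((u n : ℝ) + 1) +
        dist x' x * (2 * dist x (y (u n)) + dist x' x) / (2 * t)) Filter.atTop
        (nhds (hopfLax φ t x + 0 + dist x' x * (2 * D + dist x' x) / (2 * t))) :=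
      (h0.const_add _).add ((((hlim'.const_mul 2).add_const _).const_mul _).div_const _)
    rw [add_zero] at h1
    refine ge_of_tendsto' h1 fun n ↦ ?_
    have h2 := hopfLax_le hφ ht x' (y (u n))
    have h3 : dist x' (y (u n)) ^ 2 / (2 * t) ≤
        (dist x' x + dist x (y (u n))) ^ 2 / (2 * t) := by
      gcongr
      exact dist_triangle _ _ _
    have h4 : (dist x' x + dist x (y (u n))) ^ 2 / (2 * t) = dist x (y (u n)) ^ 2 / (2 * t) +
        dist x' x * (2 * dist x (y (u n)) + dist x' x) / (2 * t) := by ring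
    linarith [hy (u n)]

theorem hopfLax_anti (hφ : ∀ x, |φ x| ≤ C) (ht : 0 < t) {s : ℝ} (hts : t ≤ s) (x : X) :
    hopfLax φ s x ≤ hopfLax φ t x := by
  obtain ⟨D, -, -, h, -⟩ := exists_hopfLax_bounds hφ ht x
  have h1 := h s (ht.trans_le hts)
  have h2 : D ^ 2 / (2 * s) ≤ D ^ 2 / (2 * t) := by gcongr
  linarith

/-- At distance at most `1` the growth bound applies, with `D ≤ 4 t C + 1` from `D ^ 2 ≤ 4 t C`; at
larger distances the oscillation `2 C` is at most `2 C` times the distance. -/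
theorem exists_lipschitzWith_hopfLax (hφ : ∀ x, |φ x| ≤ C) (ht : 0 < t) :
    ∃ K, LipschitzWith K (hopfLax φ t) := by
  rcases isEmpty_or_nonempty X with hX | ⟨⟨x₀⟩⟩
  · exact ⟨0, fun x ↦ hX.elim x⟩
  have hC : 0 ≤ C := (abs_nonneg _).trans (hφ x₀)
  refine ⟨(2 * C + (2 * (4 * t * C + 1) + 1) / (2 * t)).toNNReal,
    LipschitzWith.of_le_add_mul _ fun x' x ↦ ?_⟩
  rw [Real.coe_toNNReal _ (by positivity)]
  obtain ⟨D, hD0, hD, -, h⟩ := exists_hopfLax_bounds hφ ht x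
  have hd : 0 ≤ dist x' x := dist_nonneg
  rcases le_total (dist x' x) 1 with h1 | h1
  · refine (h x').trans ?_
    have hD' : D ≤ 4 * t * C + 1 := by nlinarith
    have : dist x' x * (2 * D + dist x' x) / (2 * t) ≤
        dist x' x * (2 * (4 * t * C + 1) + 1) / (2 * t) := by gcongr
    have h2 : 0 ≤ 2 * C * dist x' x := by positivity
    have h3 : dist x' x * (2 * (4 * t * C + 1) + 1) / (2 * t) =
      (2 * (4 * t * C + 1) + 1) / (2 * t) * dist x' x := by ring
    linarith
  · have h2 := (abs_le.1 (abs_hopfLax_le hφ ht x')).2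
    have h3 := (abs_le.1 (abs_hopfLax_le hφ ht x)).1
    have h4 : 0 ≤ (2 * (4 * t * C + 1) + 1) / (2 * t) * dist x' x := by positivity
    nlinarith

end HopfLax

/-! ### Negligibility of the boundary and slopes at interior points -/

section Riemannian

variable {d : ℕ} {H : Type*} [TopologicalSpace H]
  {I : ModelWithCorners ℝ (EuclideanSpace ℝ (Fin d)) H}
  {M : Type*}

/-- The boundary of a Riemannian manifold is negligible. -/
theorem riemannianVolume_boundary [TopologicalSpace M] [ChartedSpace H M] [IsManifold I 1 M]
    [RiemannianBundle (fun x : M ↦ TangentSpace I x)] [MeasurableSpace M] [BorelSpace M] :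
    riemannianVolume I M (I.boundary M) = 0 := by
  have hclosed : IsClosed (I.boundary M) := I.isClosed_boundary (n := 1) one_ne_zero
  have hnull (x₀ : M) : chartVolume I x₀ (I.boundary M) = 0 := by
    rw [chartVolume]
    set e := extChartAt I x₀
    set m := (volume.restrict e.target).withDensity
      fun y ↦ ENNReal.ofReal √(gramMatrix I x₀ y).det
    by_cases hm : AEMeasurable e.symm m
    swap
    · simp [Measure.map_of_not_aemeasurable hm]
    rw [Measure.map_apply_of_aemeasurable hm hclosed.measurableSet]
    refine withDensity_absolutelyContinuous _ _ ?_
    have hsub : e.symm ⁻¹' (I.boundary M) ∩ e.target ⊆ frontier (range I) := by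
      rintro y ⟨hy, hyt⟩
      have hs : e.symm y ∈ (chartAt H x₀).source := by
        have := e.map_target hyt
        rwa [extChartAt_source] at this
      have h := (I.isBoundaryPoint_iff_of_mem_atlas (n := 1) one_ne_zero
        (chart_mem_atlas H x₀) hs).1 hy
      have h2 : (chartAt H x₀).extend I (e.symm y) = y := e.right_inv hyt
      rw [h2, OpenPartialHomeomorph.extend_target, inter_comm] at h
      have hy' : y ∈ I.symm ⁻¹' (chartAt H x₀).target := by
        rw [extChartAt_target] at hyt
        exact hyt.1
      exact ((frontier_inter_open_inter
        ((chartAt H x₀).open_target.preimage I.continuous_symm)).subset ⟨h, hy'⟩).1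
    have htarget : MeasurableSet e.target := by
      rw [show e.target = I.symm ⁻¹' (chartAt H x₀).target ∩ range I from extChartAt_target I x₀]
      exact ((chartAt H x₀).open_target.preimage I.continuous_symm).measurableSet.inter
        I.isClosed_range.measurableSet
    rw [Measure.restrict_apply' htarget]
    exact measure_mono_null hsub (I.convex_range.addHaar_frontier volume)
  -- A supremum of measures is not computed set by set, so nullity is transferred by order: each
  -- chart volume lies below the volume restricted to the complement of the boundary, hence so does
  -- the supremum.
  have hle : riemannianVolume I M ≤ (riemannianVolume I M).restrict (I.boundary M)ᶜ := by
    refine iSup_le fun x₀ ↦ ?_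
    rw [← Measure.restrict_eq_self_of_ae_mem (s := (I.boundary M)ᶜ) (μ := chartVolume I x₀)
      (measure_eq_zero_iff_ae_notMem.1 (hnull x₀))]
    exact Measure.restrict_mono subset_rfl (le_iSup (chartVolume I) x₀)
  refine le_antisymm ((hle _).trans_eq ?_) zero_le
  rw [Measure.restrict_apply hclosed.measurableSet, inter_compl_self, measure_empty]

/-- The coordinate line through `x` in the direction `v`, read in the chart at `x`. -/
noncomputable def chartLine [TopologicalSpace M] [ChartedSpace H M]
    (I : ModelWithCorners ℝ (EuclideanSpace ℝ (Fin d)) H) (x : M)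
    (v : EuclideanSpace ℝ (Fin d)) (s : ℝ) : M :=
  (extChartAt I x).symm (extChartAt I x x + s • v)

section Chart

variable [TopologicalSpace M] [ChartedSpace H M] {x : M}

theorem chartLine_zero (x : M) (v : EuclideanSpace ℝ (Fin d)) : chartLine I x v 0 = x := by
  simp [chartLine]

theorem extChartAt_target_mem_nhds_of_isInteriorPoint (hx : I.IsInteriorPoint x) :
    (extChartAt I x).target ∈ nhds (extChartAt I x x) := by
  have h := extChartAt_target_mem_nhdsWithin (I := I) x
  rwa [nhdsWithin_eq_nhds.2 (mem_interior_iff_mem_nhds.1 hx)] at h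

theorem tendsto_add_smul (y v : EuclideanSpace ℝ (Fin d)) :
    Filter.Tendsto (fun s : ℝ ↦ y + s • v) (nhds 0) (nhds y) := by
  have : Continuous fun s : ℝ ↦ y + s • v := by fun_prop
  simpa using this.tendsto 0

theorem hasMFDerivAt_chartLine (hx : I.IsInteriorPoint x) (v : EuclideanSpace ℝ (Fin d)) :
    HasMFDerivAt 𝓘(ℝ, ℝ) I (chartLine I x v) 0
      (ContinuousLinearMap.toSpanSingleton ℝ v : ℝ →L[ℝ] EuclideanSpace ℝ (Fin d)) := by
  have htend := tendsto_add_smul (extChartAt I x x) v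
  refine ⟨?_, ?_⟩
  · rw [ContinuousAt, chartLine_zero]
    have := (continuousAt_extChartAt_symm (I := I) x).tendsto
    rw [extChartAt_to_inv] at this
    exact this.comp htend
  · have h1 : HasFDerivAt (fun s : ℝ ↦ extChartAt I x x + s • v)
        (ContinuousLinearMap.toSpanSingleton ℝ v) 0 := by
      simpa using ((ContinuousLinearMap.toSpanSingleton ℝ v).hasFDerivAt (x := (0 : ℝ))).const_add
        (extChartAt I x x)
    refine HasFDerivAt.hasFDerivWithinAt ?_
    refine HasFDerivAt.congr_of_eventuallyEq h1 ?_
    filter_upwards [htend (extChartAt_target_mem_nhds_of_isInteriorPoint hx)] with s hs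
    simp only [writtenInExtChartAt, chartLine_zero, Function.comp_apply,
      extChartAt_model_space_eq_id,
      PartialEquiv.refl_symm, PartialEquiv.refl_coe, id_eq]
    exact (extChartAt I x).right_inv hs

theorem exists_contMDiffOn_chartLine [IsManifold I 1 M] (hx : I.IsInteriorPoint x)
    (v : EuclideanSpace ℝ (Fin d)) :
    ∃ δ > 0, ContMDiffOn 𝓘(ℝ, ℝ) I 1 (chartLine I x v) (Metric.ball 0 δ) := by
  obtain ⟨δ, hδ, h⟩ := Metric.mem_nhds_iff.1 (tendsto_add_smul (extChartAt I x x) v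
    (extChartAt_target_mem_nhds_of_isInteriorPoint hx))
  refine ⟨δ, hδ, (contMDiffOn_extChartAt_symm x).comp ?_ h⟩
  rw [contMDiffOn_iff_contDiffOn]
  exact ContDiff.contDiffOn (by fun_prop)

theorem hasDerivAt_comp_chartLine (hx : I.IsInteriorPoint x) {φ : M → ℝ}
    (hφ : MDifferentiableAt I 𝓘(ℝ, ℝ) φ x) (v : TangentSpace I x) :
    HasDerivAt (F := ℝ) (fun s ↦ φ (chartLine I x v s)) (mfderiv I 𝓘(ℝ, ℝ) φ x v) 0 := by
  have h0 : chartLine I x v 0 = x := chartLine_zero x v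
  have h1 := HasMFDerivAt.comp (x := (0 : ℝ)) (g := φ) (I' := I) (I'' := 𝓘(ℝ, ℝ))
    (f := chartLine I x v) (g' := mfderiv I 𝓘(ℝ, ℝ) φ x) (by rw [h0]; exact hφ.hasMFDerivAt)
    (hasMFDerivAt_chartLine hx v)
  have h2 : HasFDerivAt (fun s ↦ φ (chartLine I x v s)) ((mfderiv I 𝓘(ℝ, ℝ) φ x).comp
      (ContinuousLinearMap.toSpanSingleton ℝ v) : ℝ →L[ℝ] ℝ) 0 :=
    hasMFDerivAt_iff_hasFDerivAt.1 h1
  have h3 (L : ℝ →L[ℝ] ℝ) (hL : HasFDerivAt (fun s ↦ φ (chartLine I x v s)) L 0) :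
      HasDerivAt (fun s ↦ φ (chartLine I x v s)) (L 1) 0 := hL.hasDerivAt
  have h4 : mfderiv I 𝓘(ℝ, ℝ) φ x ((1 : ℝ) • v) = mfderiv I 𝓘(ℝ, ℝ) φ x v := by rw [one_smul]
  rw [← h4]
  exact h3 _ h2

end Chart

variable [PseudoMetricSpace M] [ChartedSpace H M] [IsManifold I 1 M]
    [RiemannianBundle (fun x : M ↦ TangentSpace I x)]
    [IsContinuousRiemannianBundle (EuclideanSpace ℝ (Fin d)) (fun x : M ↦ TangentSpace I x)]
    {x : M}

/-- The velocity of a coordinate line is a continuous curve in the tangent bundle, equal to `v` at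
time `0`, and the metric is continuous. -/
theorem eventually_norm_mfderiv_chartLine_lt (hx : I.IsInteriorPoint x) (v : TangentSpace I x)
    {r : ℝ} (hr : ‖v‖ < r) : ∀ᶠ s in nhds (0 : ℝ),
      ‖mfderiv 𝓘(ℝ, ℝ) I (chartLine I x v) s 1‖ < r := by
  obtain ⟨δ, hδ, hsm⟩ := exists_contMDiffOn_chartLine hx v
  have hball : Metric.ball (0 : ℝ) δ ∈ nhds 0 := Metric.ball_mem_nhds _ hδ
  have hcont := hsm.continuousOn_tangentMapWithin le_rfl Metric.isOpen_ball.uniqueMDiffOn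
  have hsec : Continuous fun s : ℝ ↦ (⟨s, (1 : ℝ)⟩ : TangentBundle 𝓘(ℝ, ℝ) ℝ) :=
    (tangentBundleModelSpaceHomeomorph 𝓘(ℝ, ℝ)).symm.continuous.comp
      (continuous_id.prodMk continuous_const)
  have h1 : ContinuousAt (fun s : ℝ ↦ tangentMapWithin 𝓘(ℝ, ℝ) I (chartLine I x v)
      (Metric.ball 0 δ) ⟨s, (1 : ℝ)⟩) 0 :=
    (hcont.comp hsec.continuousOn (fun s hs ↦ hs)).continuousAt hball
  have h2 : ContinuousAt (fun s : ℝ ↦ (⟨chartLine I x v s,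
      mfderiv 𝓘(ℝ, ℝ) I (chartLine I x v) s 1⟩ : TangentBundle I M)) 0 := by
    refine h1.congr ?_
    filter_upwards [hball] with s hs
    rw [tangentMapWithin, mfderivWithin_of_isOpen Metric.isOpen_ball hs]
    rfl
  have h3 : ContinuousAt (fun s : ℝ ↦ ‖mfderiv 𝓘(ℝ, ℝ) I (chartLine I x v) s 1‖) 0 := by
    have h := (ContinuousAt.inner_bundle h2 h2).sqrt
    simpa only [← norm_eq_sqrt_real_inner] using h
  have h0 : chartLine I x v 0 = x := chartLine_zero x v
  have h4 : (⟨chartLine I x v 0, mfderiv 𝓘(ℝ, ℝ) I (chartLine I x v) 0 1⟩ : TangentBundle I M) =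
      ⟨x, v⟩ := by
    have h5 : mfderiv 𝓘(ℝ, ℝ) I (chartLine I x v) 0 =
      (ContinuousLinearMap.toSpanSingleton ℝ v : ℝ →L[ℝ] EuclideanSpace ℝ (Fin d)) :=
      (hasMFDerivAt_chartLine hx v).mfderiv
    have h6 : @Eq (EuclideanSpace ℝ (Fin d)) (mfderiv 𝓘(ℝ, ℝ) I (chartLine I x v) 0 1) v := by
      rw [h5]
      exact one_smul ℝ (v : EuclideanSpace ℝ (Fin d))
    exact TotalSpace.ext h0 (heq_of_eq h6)
  have h5 : ‖mfderiv 𝓘(ℝ, ℝ) I (chartLine I x v) 0 1‖ = ‖v‖ :=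
    congrArg (fun p : TangentBundle I M ↦ ‖p.2‖) h4
  exact h3.eventually_lt continuousAt_const (h5.trans_lt hr)

/-- The Riemannian distance is at most the length of the coordinate line, whose speed stays below
`r`. -/
theorem eventually_dist_chartLine_le [IsRiemannianManifold I M] (hx : I.IsInteriorPoint x)
    (v : TangentSpace I x) {r : ℝ} (hr : ‖v‖ < r) :
    ∀ᶠ s in nhdsWithin (0 : ℝ) (Ioi 0), dist (chartLine I x v s) x ≤ r * s := by
  have hr0 : 0 ≤ r := (norm_nonneg v).trans hr.le
  obtain ⟨δ, hδ, hsm⟩ := exists_contMDiffOn_chartLine hx v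
  obtain ⟨δ', hδ', hnorm⟩ := Metric.eventually_nhds_iff.1
    (eventually_norm_mfderiv_chartLine_lt hx v hr)
  filter_upwards [Ioo_mem_nhdsGT (lt_min hδ hδ')] with s hs
  have habs (t : ℝ) (ht : t ∈ Icc 0 s) : dist t 0 < min δ δ' := by
    rw [Real.dist_0_eq_abs, abs_of_nonneg ht.1]
    exact ht.2.trans_lt hs.2
  have h1 : edist x (chartLine I x v s) ≤ ENNReal.ofReal (r * s) := by
    rw [IsRiemannianManifold.out (I := I) x (chartLine I x v s)]
    refine (Manifold.riemannianEDist_le_pathELength (hsm.mono fun t ht ↦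
      (habs t ht).trans_le (min_le_left _ _)) (chartLine_zero x v) rfl hs.1.le).trans ?_
    rw [Manifold.pathELength_eq_lintegral_mfderiv_Icc]
    calc ∫⁻ t in Icc 0 s, ‖mfderiv 𝓘(ℝ, ℝ) I (chartLine I x v) t 1‖ₑ
        ≤ ∫⁻ t in Icc 0 s, ENNReal.ofReal r := by
          refine setLIntegral_mono' measurableSet_Icc fun t ht ↦ ?_
          rw [← ofReal_norm]
          exact ENNReal.ofReal_le_ofReal (hnorm ((habs t ht).trans_le (min_le_right _ _))).le
      _ = ENNReal.ofReal (r * s) := by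
          rw [lintegral_const, Measure.restrict_apply_univ, Real.volume_Icc, sub_zero,
            ENNReal.ofReal_mul hr0]
  rw [dist_comm, dist_edist]
  exact ENNReal.toReal_le_of_le_ofReal (mul_nonneg hr0 hs.1.le) h1

/-- A growth bound of a function controls its derivative at interior points. -/
theorem mfderiv_le_of_growth [IsRiemannianManifold I M] (hx : I.IsInteriorPoint x) {φ : M → ℝ}
    {D t : ℝ} (ht : 0 < t) (hD : 0 ≤ D)
    (h : ∀ x', φ x' ≤ φ x + dist x' x * (2 * D + dist x' x) / (2 * t)) (v : TangentSpace I x) :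
    @LE.le ℝ _ (mfderiv I 𝓘(ℝ, ℝ) φ x v) (‖v‖ * D / t) := by
  -- Where `φ` is not differentiable, `mfderiv` is zero by default and the bound is trivial, so
  -- Rademacher's theorem is not needed.
  by_cases hφ : MDifferentiableAt I 𝓘(ℝ, ℝ) φ x
  swap
  · rw [mfderiv_zero_of_not_mdifferentiableAt hφ]
    change (0 : ℝ) ≤ _
    positivity
  have hder := hasDerivAt_comp_chartLine hx hφ v
  have key (r : ℝ) (hr : ‖v‖ < r) : @LE.le ℝ _ (mfderiv I 𝓘(ℝ, ℝ) φ x v) (r * D / t) := by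
    have hr0 : 0 ≤ r := (norm_nonneg v).trans hr.le
    have h1 := hder.tendsto_slope_zero_right
    have h2 : Filter.Tendsto (fun s : ℝ ↦ r * (2 * D + r * s) / (2 * t)) (nhdsWithin 0 (Ioi 0))
        (nhds (r * D / t)) := by
      have : Continuous fun s : ℝ ↦ r * (2 * D + r * s) / (2 * t) := by fun_prop
      have := (this.tendsto 0).mono_left (nhdsWithin_le_nhds (s := Ioi 0))
      convert this using 2
      field_simp
      ring
    refine le_of_tendsto_of_tendsto h1 h2 ?_
    filter_upwards [eventually_dist_chartLine_le hx v hr, self_mem_nhdsWithin] with s hs hs0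
    have hs0 : 0 < s := hs0
    have h00 : chartLine I x v 0 = x := chartLine_zero x v
    simp only [zero_add, smul_eq_mul]
    rw [h00]
    rw [inv_mul_le_iff₀ hs0]
    have h3 := h (chartLine I x v s)
    have h4 : dist (chartLine I x v s) x * (2 * D + dist (chartLine I x v s) x) / (2 * t) ≤
        r * s * (2 * D + r * s) / (2 * t) := by gcongr
    have h5 : s * (r * (2 * D + r * s) / (2 * t)) = r * s * (2 * D + r * s) / (2 * t) := by ring
    linarith
  have hlim : Filter.Tendsto (fun r : ℝ ↦ r * D / t) (nhdsWithin ‖v‖ (Ioi ‖v‖))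
      (nhds (‖v‖ * D / t)) := by
    have : Continuous fun r : ℝ ↦ r * D / t := by fun_prop
    exact (this.tendsto _).mono_left nhdsWithin_le_nhds
  exact ge_of_tendsto hlim (eventually_nhdsWithin_of_forall fun r hr ↦ key r hr)

end Riemannian

/-! ### The logarithmic mean as a time average -/

theorem lintegral_inv_segment_of_pos {a b : ℝ} (ha : 0 < a) (hb : 0 < b) :
    ∫⁻ s in Icc (0 : ℝ) 1, (ENNReal.ofReal ((1 - s) * a + s * b))⁻¹ =
      (ENNReal.ofReal (logMean a b))⁻¹ := by
  have hpos (s : ℝ) (hs : s ∈ Icc (0 : ℝ) 1) : 0 < (1 - s) * a + s * b := by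
    rcases hs.1.eq_or_lt with rfl | h
    · simpa using ha
    · have := mul_nonneg (sub_nonneg.2 hs.2) ha.le
      have := mul_pos h hb
      linarith
  by_cases hab : a = b
  · subst hab
    have (s : ℝ) : (1 - s) * a + s * a = a := by ring
    simp [this, logMean, ha]
  have hcont : ContinuousOn (fun s : ℝ ↦ ((1 - s) * a + s * b)⁻¹) (Icc 0 1) :=
    ContinuousOn.inv₀ (by fun_prop) fun s hs ↦ (hpos s hs).ne'
  have hint : ∫ s in (0 : ℝ)..1, ((1 - s) * a + s * b)⁻¹ =
      (Real.log a - Real.log b) / (a - b) := by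
    have hba : b - a ≠ 0 := sub_ne_zero.2 (Ne.symm hab)
    have hab' : a - b ≠ 0 := sub_ne_zero.2 hab
    rw [intervalIntegral.integral_eq_sub_of_hasDerivAt
      (f := fun s ↦ Real.log ((1 - s) * a + s * b) / (b - a))]
    · simp only [sub_self, zero_mul, one_mul, zero_add, sub_zero, add_zero]
      rw [← sub_div, ← neg_sub (Real.log a), ← neg_sub a b, neg_div_neg_eq]
    · intro s hs
      rw [uIcc_of_le zero_le_one] at hs
      have h1 : HasDerivAt (fun s : ℝ ↦ (1 - s) * a + s * b) (b - a) s := by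
        have := (((hasDerivAt_id s).const_sub 1).mul_const a).add ((hasDerivAt_id s).mul_const b)
        exact this.congr_deriv (by ring)
      have h2 := (h1.log (hpos s hs).ne').div_const (b - a)
      exact h2.congr_deriv (by field_simp)
    · exact ContinuousOn.intervalIntegrable (by rwa [uIcc_of_le zero_le_one])
  have hlog : 0 < (Real.log a - Real.log b) / (a - b) := by
    rcases lt_or_gt_of_ne hab with h | h
    · exact div_pos_of_neg_of_neg (sub_neg.2 (Real.log_lt_log ha h)) (sub_neg.2 h)
    · exact div_pos (sub_pos.2 (Real.log_lt_log hb h)) (sub_pos.2 h)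
  calc ∫⁻ s in Icc (0 : ℝ) 1, (ENNReal.ofReal ((1 - s) * a + s * b))⁻¹
      = ∫⁻ s in Icc (0 : ℝ) 1, ENNReal.ofReal ((1 - s) * a + s * b)⁻¹ :=
        setLIntegral_congr_fun measurableSet_Icc fun s hs ↦
          (ENNReal.ofReal_inv_of_pos (hpos s hs)).symm
    _ = ENNReal.ofReal (∫ s in Icc (0 : ℝ) 1, ((1 - s) * a + s * b)⁻¹) := by
        rw [ofReal_integral_eq_lintegral_ofReal (hcont.integrableOn_Icc)]
        exact (ae_restrict_iff' measurableSet_Icc).2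
          (Filter.Eventually.of_forall fun s hs ↦ (inv_pos.2 (hpos s hs)).le)
    _ = ENNReal.ofReal ((Real.log a - Real.log b) / (a - b)) := by
        rw [integral_Icc_eq_integral_Ioc, ← intervalIntegral.integral_of_le zero_le_one, hint]
    _ = (ENNReal.ofReal (logMean a b))⁻¹ := by
        have : logMean a b = ((Real.log a - Real.log b) / (a - b))⁻¹ := by
          simp [logMean, ha, hb, hab]
        rw [this, ENNReal.ofReal_inv_of_pos hlog, inv_inv]

/-- The mean of the reciprocals on a segment is the reciprocal of the logarithmic mean. -/
theorem lintegral_inv_segment {a b : ℝ} (ha : 0 < a) (hb : 0 ≤ b) :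
    ∫⁻ s in Icc (0 : ℝ) 1, (ENNReal.ofReal ((1 - s) * a + s * b))⁻¹ =
      (ENNReal.ofReal (logMean a b))⁻¹ := by
  rcases hb.eq_or_lt with rfl | hb
  swap
  · exact lintegral_inv_segment_of_pos ha hb
  have h0 : logMean a 0 = 0 := by simp [logMean]
  rw [h0, ENNReal.ofReal_zero, ENNReal.inv_zero]
  have key (n : ℕ) : (ENNReal.ofReal (a * (1 / ((n : ℝ) + 1))))⁻¹ ≤
      ∫⁻ s in Icc (0 : ℝ) 1, (ENNReal.ofReal ((1 - s) * a + s * 0))⁻¹ := by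
    have hn : (0 : ℝ) < (n : ℝ) + 1 := by positivity
    -- With this `b` the logarithms differ by exactly `n + 1`, so `logMean a b ≤ a / (n + 1)`;
    -- comparison shows that the integral at `b = 0` diverges.
    set b := a * Real.exp (-((n : ℝ) + 1))
    have hb : 0 < b := by positivity
    have hba : b < a := mul_lt_of_lt_one_right ha (Real.exp_lt_one_iff.2 (by linarith))
    have hlog : Real.log b = Real.log a - ((n : ℝ) + 1) := by
      rw [Real.log_mul ha.ne' (Real.exp_ne_zero _), Real.log_exp]; ring
    have hmean : logMean a b ≤ a * (1 / ((n : ℝ) + 1)) := by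
      simp only [logMean, ha, hb, and_self, if_true, hba.ne', if_false, hlog]
      rw [sub_sub_cancel, mul_one_div]
      gcongr
      linarith
    calc (ENNReal.ofReal (a * (1 / ((n : ℝ) + 1))))⁻¹ ≤ (ENNReal.ofReal (logMean a b))⁻¹ := by
          gcongr
      _ = ∫⁻ s in Icc (0 : ℝ) 1, (ENNReal.ofReal ((1 - s) * a + s * b))⁻¹ :=
          (lintegral_inv_segment_of_pos ha hb).symm
      _ ≤ _ := by
          refine setLIntegral_mono' measurableSet_Icc fun s hs ↦ ?_
          gcongr
          exact hs.1
  have hlim : Filter.Tendsto (fun n : ℕ ↦ (ENNReal.ofReal (a * (1 / ((n : ℝ) + 1))))⁻¹)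
      Filter.atTop (nhds ⊤) := by
    have h1 := (tendsto_one_div_add_atTop_nhds_zero_nat (𝕜 := ℝ)).const_mul a
    rw [mul_zero] at h1
    have h2 := ENNReal.tendsto_ofReal h1
    rw [ENNReal.ofReal_zero] at h2
    have h3 := tendsto_inv_iff.2 h2
    simpa using h3
  exact top_unique (le_of_tendsto' hlim key)

/-- Tonelli, then the pointwise identity. The conventions `0 / 0 = 0` and `c / 0 = ∞` agree on both
sides since `g` is a factor that is constant in time and finite. -/
theorem lintegral_lintegral_div_segment {X : Type*} [MeasurableSpace X] {m : Measure X} [SFinite m]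
    {u₀ u₁ : X → ℝ} (hu₀ : AEMeasurable u₀ m) (hu₁ : AEMeasurable u₁ m) (h₀ : ∀ᵐ x ∂m, 0 < u₀ x)
    (h₁ : ∀ᵐ x ∂m, 0 ≤ u₁ x) {g : X → ℝ≥0∞} (hg : AEMeasurable g m) (hg' : ∀ x, g x ≠ ⊤) :
    ∫⁻ s in Icc (0 : ℝ) 1, ∫⁻ x, g x / ENNReal.ofReal ((1 - s) * u₀ x + s * u₁ x) ∂m =
      ∫⁻ x, g x / ENNReal.ofReal (logMean (u₀ x) (u₁ x)) ∂m := by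
  have hs : AEMeasurable (fun z : ℝ × X ↦ z.1) ((volume.restrict (Icc (0 : ℝ) 1)).prod m) :=
    measurable_fst.aemeasurable
  rw [lintegral_lintegral_swap]
  · refine lintegral_congr_ae ?_
    filter_upwards [h₀, h₁] with x hx0 hx1
    simp only [div_eq_mul_inv]
    rw [lintegral_const_mul' _ _ (hg' x), lintegral_inv_segment hx0 hx1]
  · exact hg.comp_snd.div (((aemeasurable_const.sub hs).mul hu₀.comp_snd).add
      (hs.mul hu₁.comp_snd)).ennreal_ofReal

/-! ### Increments of the dual value along the linear interpolation -/

/-- An increment bound with a constant close to `1 / 2` for short intervals adds up. -/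
theorem ofReal_sub_le_half_lintegral {F : ℝ → ℝ} {E : ℝ → ℝ≥0∞}
    (h : ∀ t s, 0 < t → t < s → s < 1 → ENNReal.ofReal (F s - F t) ≤
      ENNReal.ofReal (1 / 2 * ((s / t) ^ 2 * ((1 - t) / (1 - s)))) * ∫⁻ r in Ioc t s, E r)
    {a b : ℝ} (ha : 0 < a) (hab : a < b) (hb : b < 1) :
    ENNReal.ofReal (F b - F a) ≤ ENNReal.ofReal (1 / 2) * ∫⁻ r in Icc 0 1, E r := by
  let δ (n : ℕ) : ℝ := (b - a) * (1 / ((n : ℝ) + 1))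
  -- The factor in `h` for steps of length `δ n`, made uniform by `t ≥ a` and `1 - s ≥ 1 - b`; it
  -- tends to `1 / 2`.
  let C (n : ℕ) : ℝ := 1 / 2 * ((1 + δ n / a) ^ 2 * (1 + δ n / (1 - b)))
  have hb' : 0 < 1 - b := sub_pos.2 hb
  have key (n : ℕ) :
      ENNReal.ofReal (F b - F a) ≤ ENNReal.ofReal (C n) * ∫⁻ r in Icc 0 1, E r := by
    have hδ : 0 < δ n := mul_pos (sub_pos.2 hab) Nat.one_div_pos_of_nat
    have hδn : ((n : ℝ) + 1) * δ n = b - a := by simp only [δ]; field_simp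
    have hstep (k : ℕ) : k ≤ n + 1 → ENNReal.ofReal (F (a + k * δ n) - F a) ≤
        ENNReal.ofReal (C n) * ∫⁻ r in Ioc a (a + k * δ n), E r := by
      induction k with
      | zero => simp
      | succ k ih =>
        intro hk
        have hk' : (k : ℝ) + 1 ≤ (n : ℝ) + 1 := by exact_mod_cast hk
        set t := a + k * δ n with ht
        have hs : a + ((k + 1 : ℕ) : ℝ) * δ n = t + δ n := by rw [ht]; push_cast; ring
        have hat : a ≤ t := by rw [ht]; have := mul_nonneg k.cast_nonneg hδ.le; linarith
        have hsb : t + δ n ≤ b := by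
          have := mul_le_mul_of_nonneg_right hk' hδ.le
          rw [hδn] at this
          rw [ht]; linarith
        have ht0 : 0 < t := ha.trans_le hat
        have hs1 : 0 < 1 - (t + δ n) := by linarith
        rw [hs]
        have h1 := h t (t + δ n) ht0 (by linarith) (by linarith)
        have hC : 1 / 2 * (((t + δ n) / t) ^ 2 * ((1 - t) / (1 - (t + δ n)))) ≤ C n := by
          have e1 : (t + δ n) / t = 1 + δ n / t := by rw [add_div, div_self ht0.ne']
          have e2 : (1 - t) / (1 - (t + δ n)) = 1 + δ n / (1 - (t + δ n)) := by
            rw [eq_comm, one_add_div hs1.ne']; congr 1; ring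
          rw [e1, e2]
          simp only [C]
          gcongr
        calc ENNReal.ofReal (F (t + δ n) - F a)
            ≤ ENNReal.ofReal (F t - F a) + ENNReal.ofReal (F (t + δ n) - F t) := by
              refine le_trans (le_of_eq ?_) ENNReal.ofReal_add_le
              congr 1; ring
          _ ≤ ENNReal.ofReal (C n) * (∫⁻ r in Ioc a t, E r) +
              ENNReal.ofReal (C n) * ∫⁻ r in Ioc t (t + δ n), E r :=
              add_le_add (ih (by omega)) (h1.trans (by gcongr))
          _ = _ := by
              rw [← mul_add, ← lintegral_union measurableSet_Ioc (Ioc_disjoint_Ioc_of_le le_rfl),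
                Ioc_union_Ioc_eq_Ioc hat (by linarith)]
    have hfin := hstep (n + 1) le_rfl
    have hab' : a + ((n + 1 : ℕ) : ℝ) * δ n = b := by push_cast; rw [hδn]; ring
    rw [hab'] at hfin
    refine hfin.trans ?_
    gcongr
    exact fun r hr ↦ ⟨(ha.trans hr.1).le, hr.2.trans hb.le⟩
  have hδlim : Filter.Tendsto δ Filter.atTop (nhds 0) := by
    have := (tendsto_one_div_add_atTop_nhds_zero_nat (𝕜 := ℝ)).const_mul (b - a)
    rwa [mul_zero] at this
  have hClim : Filter.Tendsto C Filter.atTop (nhds (1 / 2)) := by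
    have : Continuous fun r : ℝ ↦ 1 / 2 * ((1 + r / a) ^ 2 * (1 + r / (1 - b))) := by fun_prop
    have := (this.tendsto 0).comp hδlim
    rwa [zero_div, zero_div, add_zero, one_pow, mul_one, mul_one] at this
  exact ge_of_tendsto' (ENNReal.Tendsto.mul_const (ENNReal.tendsto_ofReal hClim)
    (Or.inl (by simp))) key

/-- Young's inequality in finite-difference form: the decay gives a negative quadratic term in `D`,
the slope a linear one, and the gap to the right-hand side is the perfect square in `h3`. Here `q`,
`p` are the Hopf-Lax values at times `t`, `s`, and `u`, `v` the densities. -/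
theorem hopfLax_increment_le {t s u v p q D g L : ℝ} (ht : 0 < t) (hts : t < s) (hs : s < 1)
    (hu : 0 < u) (hv : (1 - s) / (1 - t) * u ≤ v)
    (hp : p ≤ q + (D ^ 2 / (2 * s) - D ^ 2 / (2 * t))) (hL : -L ≤ g * D / t) :
    (p - q) * v - (s - t) * L ≤ (s - t) * (s * (1 - t) / (t * (1 - s))) / 2 * (g ^ 2 / u) := by
  have hs0 : 0 < s := ht.trans hts
  have h1s : 0 < 1 - s := sub_pos.2 hs
  have h1t : 0 < 1 - t := sub_pos.2 (hts.trans hs)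
  have hst : 0 < s - t := sub_pos.2 hts
  have e1 : D ^ 2 / (2 * s) - D ^ 2 / (2 * t) = -((s - t) * D ^ 2 / (2 * s * t)) := by
    field_simp; ring
  have hneg : p - q ≤ -((s - t) * D ^ 2 / (2 * s * t)) := by linarith
  have hneg0 : p - q ≤ 0 := hneg.trans (neg_nonpos.2 (by positivity))
  have h1 : (p - q) * v ≤ -((s - t) * D ^ 2 / (2 * s * t)) * ((1 - s) / (1 - t) * u) :=
    (mul_le_mul_of_nonpos_left hv hneg0).trans (mul_le_mul_of_nonneg_right hneg (by positivity))
  have h2 : -((s - t) * L) ≤ (s - t) * (g * D / t) := by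
    have := mul_le_mul_of_nonneg_left hL hst.le
    linarith
  have h3 : (s - t) * (s * (1 - t) / (t * (1 - s))) / 2 * (g ^ 2 / u) -
      (-((s - t) * D ^ 2 / (2 * s * t)) * ((1 - s) / (1 - t) * u) + (s - t) * (g * D / t)) =
      (s - t) * (s * (1 - t) * g - (1 - s) * D * u) ^ 2 / (2 * s * t * (1 - s) * (1 - t) * u) := by
    field_simp
    ring
  have h4 : 0 ≤ (s - t) * (s * (1 - t) * g - (1 - s) * D * u) ^ 2 /
      (2 * s * t * (1 - s) * (1 - t) * u) := by positivity
  linarith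

section Interpolation

variable {X : Type*} [MeasurableSpace X] {m : Measure X} {u₀ u₁ g : X → ℝ}

/-- A discrete product rule: the change of `Q` is paired with the density at time `s`, and the
change of density with `Q` at time `t`, where the weak equation applies. `D` enters only pointwise
and disappears before integration. -/
theorem ofReal_integral_increment_le (hu₀ : Integrable u₀ m) (hu₁ : Integrable u₁ m)
    (h₀ : ∀ᵐ x ∂m, 0 < u₀ x) (h₁ : ∀ᵐ x ∂m, 0 ≤ u₁ x) (hg : AEStronglyMeasurable g m)
    {P Q L : X → ℝ} {C : ℝ} (hPm : AEStronglyMeasurable P m) (hQm : AEStronglyMeasurable Q m)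
    (hP : ∀ x, |P x| ≤ C) (hQ : ∀ x, |Q x| ≤ C)
    (hL : -∫ x, L x ∂m = ∫ x, Q x * (u₁ x - u₀ x) ∂m) {t s : ℝ} (ht : 0 < t) (hts : t < s)
    (hs : s < 1) (hD : ∀ᵐ x ∂m, ∃ D : ℝ, P x ≤ Q x + (D ^ 2 / (2 * s) - D ^ 2 / (2 * t)) ∧
      -L x ≤ g x * D / t) :
    ENNReal.ofReal (∫ x, P x * ((1 - s) * u₀ x + s * u₁ x) ∂m -
        ∫ x, Q x * ((1 - t) * u₀ x + t * u₁ x) ∂m) ≤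
      ENNReal.ofReal ((s - t) * (s * (1 - t) / (t * (1 - s))) / 2) *
        ∫⁻ x, ENNReal.ofReal (g x ^ 2 / ((1 - t) * u₀ x + t * u₁ x)) ∂m := by
  have hs0 : 0 < s := ht.trans hts
  have h1s : 0 < 1 - s := sub_pos.2 hs
  have h1t : 0 < 1 - t := sub_pos.2 (hts.trans hs)
  have hst : 0 < s - t := sub_pos.2 hts
  set κ := (s - t) * (s * (1 - t) / (t * (1 - s))) / 2 with hκ
  have hκ0 : 0 < κ := by positivity
  by_cases htop : ∫⁻ x, ENNReal.ofReal (g x ^ 2 / ((1 - t) * u₀ x + t * u₁ x)) ∂m = ⊤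
  · rw [htop, ENNReal.mul_top (by simpa using hκ0)]
    exact le_top
  have hut : Integrable (fun x ↦ (1 - t) * u₀ x + t * u₁ x) m :=
    (hu₀.const_mul _).add (hu₁.const_mul _)
  have hus : Integrable (fun x ↦ (1 - s) * u₀ x + s * u₁ x) m :=
    (hu₀.const_mul _).add (hu₁.const_mul _)
  have hut0 : ∀ᵐ x ∂m, 0 < (1 - t) * u₀ x + t * u₁ x := by
    filter_upwards [h₀, h₁] with x hx0 hx1
    have := mul_pos h1t hx0
    have := mul_nonneg ht.le hx1
    linarith
  have hus0 : ∀ᵐ x ∂m, (1 - s) / (1 - t) * ((1 - t) * u₀ x + t * u₁ x) ≤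
      (1 - s) * u₀ x + s * u₁ x := by
    filter_upwards [h₀, h₁] with x hx0 hx1
    have e : (1 - s) / (1 - t) * ((1 - t) * u₀ x + t * u₁ x) =
        (1 - s) * u₀ x + (1 - s) * t / (1 - t) * u₁ x := by field_simp
    have : (1 - s) * t / (1 - t) ≤ s := by
      rw [div_le_iff₀ h1t]; nlinarith
    rw [e]
    gcongr
  have hbint : Integrable (fun x ↦ g x ^ 2 / ((1 - t) * u₀ x + t * u₁ x)) m := by
    refine ⟨((hg.aemeasurable.pow_const 2).div hut.aemeasurable).aestronglyMeasurable, ?_⟩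
    rw [hasFiniteIntegral_iff_ofReal]
    · exact lt_top_iff_ne_top.2 htop
    · filter_upwards [hut0] with x hx
      positivity
  have hnb (f : X → ℝ) (hf : ∀ x, |f x| ≤ C) : ∀ᵐ x ∂m, ‖f x‖ ≤ C :=
    Filter.Eventually.of_forall hf
  have hPs := hus.bdd_mul hPm (hnb P hP)
  have hQs := hus.bdd_mul hQm (hnb Q hQ)
  have hQt := hut.bdd_mul hQm (hnb Q hQ)
  have hQd : Integrable (fun x ↦ Q x * (u₁ x - u₀ x)) m := (hu₁.sub hu₀).bdd_mul hQm (hnb Q hQ)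
  have hdiff : ∫ x, P x * ((1 - s) * u₀ x + s * u₁ x) ∂m -
      ∫ x, Q x * ((1 - t) * u₀ x + t * u₁ x) ∂m =
      ∫ x, (P x - Q x) * ((1 - s) * u₀ x + s * u₁ x) ∂m - (s - t) * ∫ x, L x ∂m := by
    have e1 : ∫ x, (P x - Q x) * ((1 - s) * u₀ x + s * u₁ x) ∂m =
        ∫ x, P x * ((1 - s) * u₀ x + s * u₁ x) ∂m -
          ∫ x, Q x * ((1 - s) * u₀ x + s * u₁ x) ∂m := by
      rw [← integral_sub hPs hQs]
      simp_rw [sub_mul]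
    have e2 : ∫ x, Q x * ((1 - s) * u₀ x + s * u₁ x) ∂m =
        ∫ x, Q x * ((1 - t) * u₀ x + t * u₁ x) ∂m + (s - t) * ∫ x, Q x * (u₁ x - u₀ x) ∂m := by
      rw [← integral_const_mul, ← integral_add hQt (hQd.const_mul _)]
      congr 1 with x
      ring
    rw [e1, e2, ← hL]
    ring
  have hPQs : Integrable (fun x ↦ (P x - Q x) * ((1 - s) * u₀ x + s * u₁ x)) m := by
    refine (hPs.sub hQs).congr (Filter.Eventually.of_forall fun x ↦ ?_)
    simp only [Pi.sub_apply]
    ring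
  have hfinal : ∫ x, (P x - Q x) * ((1 - s) * u₀ x + s * u₁ x) ∂m - (s - t) * ∫ x, L x ∂m ≤
      κ * ∫ x, g x ^ 2 / ((1 - t) * u₀ x + t * u₁ x) ∂m := by
    -- If `L` is not integrable its Bochner integral is zero by default, and the remaining term is
    -- nonpositive because `P ≤ Q` almost everywhere.
    by_cases hLint : Integrable L m
    · rw [← integral_const_mul, ← integral_sub hPQs (hLint.const_mul _), ← integral_const_mul]
      refine integral_mono_ae (hPQs.sub (hLint.const_mul _)) (hbint.const_mul _) ?_
      filter_upwards [hD, hut0, hus0] with x ⟨D, hD1, hD2⟩ hx1 hx2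
      exact hopfLax_increment_le ht hts hs hx1 hx2 hD1 hD2
    · rw [integral_undef hLint, mul_zero, sub_zero]
      have h1 : ∫ x, (P x - Q x) * ((1 - s) * u₀ x + s * u₁ x) ∂m ≤ 0 := by
        refine integral_nonpos_of_ae ?_
        filter_upwards [hD, hut0, hus0] with x ⟨D, hD1, _⟩ hx1 hx2
        have h2 : D ^ 2 / (2 * s) ≤ D ^ 2 / (2 * t) := by gcongr
        refine mul_nonpos_of_nonpos_of_nonneg (by linarith) (le_trans ?_ hx2)
        positivity
      refine h1.trans (mul_nonneg hκ0.le (integral_nonneg_of_ae ?_))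
      filter_upwards [hut0] with x hx
      exact div_nonneg (sq_nonneg _) hx.le
  rw [hdiff, ← ofReal_integral_eq_lintegral_ofReal hbint, ← ENNReal.ofReal_mul hκ0.le]
  · exact ENNReal.ofReal_le_ofReal hfinal
  · filter_upwards [hut0] with x hx
    exact div_nonneg (sq_nonneg _) hx.le

/-- The energy of the linear interpolation at time `t` is comparable to its mean over `[t, s]`. -/
theorem mul_energy_le_lintegral (h₀ : ∀ᵐ x ∂m, 0 < u₀ x) (h₁ : ∀ᵐ x ∂m, 0 ≤ u₁ x) {t s : ℝ}
    (ht : 0 < t) (hts : t < s) (hs : s < 1) :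
    ENNReal.ofReal (s - t) *
        ∫⁻ x, ENNReal.ofReal (g x ^ 2 / ((1 - t) * u₀ x + t * u₁ x)) ∂m ≤
      ENNReal.ofReal (s / t) * ∫⁻ r in Ioc t s,
        ∫⁻ x, ENNReal.ofReal (g x ^ 2 / ((1 - r) * u₀ x + r * u₁ x)) ∂m := by
  have hs0 : 0 < s := ht.trans hts
  have key (r : ℝ) (hr : r ∈ Ioc t s) :
      ∫⁻ x, ENNReal.ofReal (g x ^ 2 / ((1 - t) * u₀ x + t * u₁ x)) ∂m ≤
      ENNReal.ofReal (s / t) *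
        ∫⁻ x, ENNReal.ofReal (g x ^ 2 / ((1 - r) * u₀ x + r * u₁ x)) ∂m := by
    rw [← lintegral_const_mul' _ _ ENNReal.ofReal_ne_top]
    refine lintegral_mono_ae ?_
    filter_upwards [h₀, h₁] with x hx0 hx1
    rw [← ENNReal.ofReal_mul (by positivity)]
    refine ENNReal.ofReal_le_ofReal ?_
    have hr0 : 0 < r := ht.trans hr.1
    have hr1 : 0 < 1 - r := by linarith [hr.2]
    have ht1 : 0 < 1 - t := by linarith
    have h1 : 0 < (1 - t) * u₀ x + t * u₁ x := by positivity
    have h2 : 0 < (1 - r) * u₀ x + r * u₁ x := by positivity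
    -- The coefficients of `u₀` and `u₁` are compared separately, which bounds `1 / u_t` by `(s / t)
    -- / u_r`.
    have h3 : t * ((1 - r) * u₀ x + r * u₁ x) ≤ s * ((1 - t) * u₀ x + t * u₁ x) := by
      have e1 : t * (1 - r) ≤ s * (1 - t) := by nlinarith [hr.1, hr.2]
      have e2 : t * r ≤ s * t := by nlinarith [hr.2]
      have := mul_le_mul_of_nonneg_right e1 hx0.le
      have := mul_le_mul_of_nonneg_right e2 hx1
      linarith
    rw [div_mul_div_comm, div_le_div_iff₀ h1 (by positivity)]
    have := mul_le_mul_of_nonneg_left h3 (sq_nonneg (g x))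
    linarith
  calc ENNReal.ofReal (s - t) *
        ∫⁻ x, ENNReal.ofReal (g x ^ 2 / ((1 - t) * u₀ x + t * u₁ x)) ∂m
      = ∫⁻ _ in Ioc t s, ∫⁻ x, ENNReal.ofReal (g x ^ 2 / ((1 - t) * u₀ x + t * u₁ x)) ∂m := by
        rw [setLIntegral_const, Real.volume_Ioc, mul_comm]
    _ ≤ ∫⁻ r in Ioc t s, ENNReal.ofReal (s / t) *
          ∫⁻ x, ENNReal.ofReal (g x ^ 2 / ((1 - r) * u₀ x + r * u₁ x)) ∂m :=
        setLIntegral_mono' measurableSet_Ioc key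
    _ = _ := lintegral_const_mul' _ _ ENNReal.ofReal_ne_top

end Interpolation

/-! ### Densities and the conclusion -/

theorem IsProbabilityDensity.isProbabilityMeasure {X : Type*} [MeasurableSpace X] {m : Measure X}
    {u : X → ℝ} (hu : IsProbabilityDensity m u) :
    IsProbabilityMeasure (m.withDensity fun x ↦ ENNReal.ofReal (u x)) := by
  refine ⟨?_⟩
  rw [withDensity_apply _ MeasurableSet.univ, Measure.restrict_univ,
    ← ofReal_integral_eq_lintegral_ofReal hu.integrable hu.nonneg, hu.integral_eq_one,
    ENNReal.ofReal_one]

theorem IsProbabilityDensity.integral_withDensity {X : Type*} [MeasurableSpace X] {m : Measure X}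
    {u : X → ℝ} (hu : IsProbabilityDensity m u) (ψ : X → ℝ) :
    ∫ x, ψ x ∂(m.withDensity fun x ↦ ENNReal.ofReal (u x)) = ∫ x, ψ x * u x ∂m := by
  rw [integral_withDensity_eq_integral_toReal_smul₀ hu.integrable.aemeasurable.ennreal_ofReal
    (Filter.Eventually.of_forall fun _ ↦ ENNReal.ofReal_lt_top)]
  refine integral_congr_ae ?_
  filter_upwards [hu.nonneg] with x hx
  simp only [ENNReal.toReal_ofReal hx, smul_eq_mul, mul_comm]

/-- The value of a pair of admissible potentials is at most the action of the linear
interpolation. -/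
theorem integral_potentials_le_action {d : ℕ} {H : Type*} [TopologicalSpace H]
    {I : ModelWithCorners ℝ (EuclideanSpace ℝ (Fin d)) H}
    {M : Type*} [MetricSpace M] [ChartedSpace H M] [IsManifold I 1 M]
    [RiemannianBundle (fun x : M ↦ TangentSpace I x)]
    [IsContinuousRiemannianBundle (EuclideanSpace ℝ (Fin d)) (fun x : M ↦ TangentSpace I x)]
    [IsRiemannianManifold I M] [MeasurableSpace M] [BorelSpace M]
    {u₀ u₁ : M → ℝ}
    (hu₀ : Integrable u₀ (riemannianVolume I M)) (hu₁ : Integrable u₁ (riemannianVolume I M))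
    (h₀ : ∀ᵐ x ∂(riemannianVolume I M), 0 < u₀ x) (h₁ : ∀ᵐ x ∂(riemannianVolume I M), 0 ≤ u₁ x)
    {G : ∀ x : M, TangentSpace I x}
    (hG : AEStronglyMeasurable (fun x ↦ ‖G x‖) (riemannianVolume I M))
    (hsol : IsWeakNeumannGradient I G (fun x ↦ u₁ x - u₀ x)) {R : ℝ} (hR : 0 ≤ R)
    (hRE : ∫⁻ r in Icc (0 : ℝ) 1, ∫⁻ x, ENNReal.ofReal (‖G x‖ ^ 2 / ((1 - r) * u₀ x + r * u₁ x))
      ∂(riemannianVolume I M) ≤ ENNReal.ofReal R)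
    {ψ χ : M → ℝ} (hψm : Measurable ψ) (hχm : Measurable χ) {C : ℝ} (hψ : ∀ x, |ψ x| ≤ C)
    (hχ : ∀ x, |χ x| ≤ C) (hψχ : ∀ x y, ψ x + χ y ≤ dist x y ^ 2) :
    ∫ x, ψ x * u₀ x ∂(riemannianVolume I M) + ∫ x, χ x * u₁ x ∂(riemannianVolume I M) ≤ R := by
  set m := riemannianVolume I M
  -- With this choice admissibility of the pair says exactly that `χ / 2 ≤ hopfLax φ 1`.
  let φ : M → ℝ := fun x ↦ -ψ x / 2
  have hφ (x : M) : |φ x| ≤ C / 2 := by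
    simp only [φ, abs_div, abs_neg, abs_two]
    linarith [hψ x]
  have hmeas (t : ℝ) (ht : 0 < t) : AEStronglyMeasurable (hopfLax φ t) m := by
    obtain ⟨K, hK⟩ := exists_lipschitzWith_hopfLax hφ ht
    exact hK.continuous.measurable.aemeasurable.aestronglyMeasurable
  let F (t : ℝ) : ℝ := ∫ x, hopfLax φ t x * ((1 - t) * u₀ x + t * u₁ x) ∂m
  let E (t : ℝ) : ℝ≥0∞ := ∫⁻ x, ENNReal.ofReal (‖G x‖ ^ 2 / ((1 - t) * u₀ x + t * u₁ x)) ∂m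
  have hint : ∀ᵐ x ∂m, I.IsInteriorPoint x := by
    have h : ∀ᵐ x ∂m, x ∉ I.boundary M :=
      measure_eq_zero_iff_ae_notMem.1 riemannianVolume_boundary
    filter_upwards [h] with x hx
    exact (I.isInteriorPoint_iff_not_isBoundaryPoint x).2 hx
  have hstep (t s : ℝ) (ht : 0 < t) (hts : t < s) (hs : s < 1) : ENNReal.ofReal (F s - F t) ≤
      ENNReal.ofReal (1 / 2 * ((s / t) ^ 2 * ((1 - t) / (1 - s)))) * ∫⁻ r in Ioc t s, E r := by
    have hs0 : 0 < s := ht.trans hts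
    have h1s : 0 < 1 - s := sub_pos.2 hs
    have h1t : 0 < 1 - t := sub_pos.2 (hts.trans hs)
    obtain ⟨K, hK⟩ := exists_lipschitzWith_hopfLax hφ ht
    have h1 := ofReal_integral_increment_le hu₀ hu₁ h₀ h₁ hG (hmeas s hs0) (hmeas t ht)
      (abs_hopfLax_le hφ hs0) (abs_hopfLax_le hφ ht)
      (hsol (hopfLax φ t) ⟨K, hK⟩ ⟨_, abs_hopfLax_le hφ ht⟩) ht hts hs (by
        filter_upwards [hint] with x hx
        obtain ⟨D, hD0, -, hD1, hD2⟩ := exists_hopfLax_bounds hφ ht x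
        refine ⟨D, hD1 s hs0, ?_⟩
        -- The slope bound is one-sided; the direction `-G x` yields the lower bound on the
        -- derivative along `G x`.
        have h := mfderiv_le_of_growth hx ht hD0 hD2 (-G x)
        rw [norm_neg, map_neg] at h
        exact h)
    have h2 := mul_energy_le_lintegral (g := fun x ↦ ‖G x‖) h₀ h₁ ht hts hs
    calc ENNReal.ofReal (F s - F t)
        ≤ ENNReal.ofReal ((s - t) * (s * (1 - t) / (t * (1 - s))) / 2) * E t := h1
      _ = ENNReal.ofReal ((s * (1 - t) / (t * (1 - s))) / 2) *
            (ENNReal.ofReal (s - t) * E t) := by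
          rw [← mul_assoc, ← ENNReal.ofReal_mul (by positivity)]
          congr 2; ring
      _ ≤ ENNReal.ofReal ((s * (1 - t) / (t * (1 - s))) / 2) *
            (ENNReal.ofReal (s / t) * ∫⁻ r in Ioc t s, E r) := by gcongr
      _ = _ := by
          rw [← mul_assoc, ← ENNReal.ofReal_mul (by positivity)]
          congr 2
          field_simp
  have hnb (f : M → ℝ) (c : ℝ) (hf : ∀ x, |f x| ≤ c) : ∀ᵐ x ∂m, ‖f x‖ ≤ c :=
    Filter.Eventually.of_forall hf
  have hut (t : ℝ) : Integrable (fun x ↦ (1 - t) * u₀ x + t * u₁ x) m :=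
    (hu₀.const_mul _).add (hu₁.const_mul _)
  have hut0 (t : ℝ) (ht0 : 0 ≤ t) (ht1 : t ≤ 1) : ∀ᵐ x ∂m, 0 ≤ (1 - t) * u₀ x + t * u₁ x := by
    filter_upwards [h₀, h₁] with x hx0 hx1
    have := mul_nonneg (sub_nonneg.2 ht1) hx0.le
    have := mul_nonneg ht0 hx1
    linarith
  have hFa (a : ℝ) (ha : 0 < a) (ha1 : a < 1) :
      F a ≤ -(∫ x, ψ x * ((1 - a) * u₀ x + a * u₁ x) ∂m) / 2 := by
    rw [← integral_neg, ← integral_div]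
    refine integral_mono_ae ((hut a).bdd_mul (hmeas a ha) (hnb _ _ (abs_hopfLax_le hφ ha)))
      ((((hut a).bdd_mul hψm.aestronglyMeasurable (hnb _ _ hψ)).neg).div_const 2) ?_
    filter_upwards [hut0 a ha.le ha1.le] with x hx
    have := mul_le_mul_of_nonneg_right (hopfLax_le_self hφ ha x) hx
    simp only [φ] at this
    linarith
  have hFb (b : ℝ) (hb : 0 < b) (hb1 : b < 1) :
      (∫ x, χ x * ((1 - b) * u₀ x + b * u₁ x) ∂m) / 2 ≤ F b := by
    rw [← integral_div]
    refine integral_mono_ae (((hut b).bdd_mul hχm.aestronglyMeasurable (hnb _ _ hχ)).div_const 2)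
      ((hut b).bdd_mul (hmeas b hb) (hnb _ _ (abs_hopfLax_le hφ hb))) ?_
    filter_upwards [hut0 b hb.le hb1.le] with x hx
    have h1 : χ x / 2 ≤ hopfLax φ 1 x := by
      have : Nonempty M := ⟨x⟩
      refine le_ciInf fun y ↦ ?_
      have := hψχ y x
      rw [dist_comm] at this
      simp only [φ]
      linarith
    have := mul_le_mul_of_nonneg_right (h1.trans (hopfLax_anti hφ hb hb1.le x)) hx
    linarith
  have hF (a b : ℝ) (ha : 0 < a) (hab : a < b) (hb : b < 1) : F b - F a ≤ R / 2 := by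
    have h := (ofReal_sub_le_half_lintegral hstep ha hab hb).trans
      (mul_le_mul_right hRE (ENNReal.ofReal (1 / 2)))
    rw [← ENNReal.ofReal_mul (by norm_num)] at h
    have := (ENNReal.ofReal_le_ofReal_iff (by positivity)).1 h
    linarith
  have hsplit (f : M → ℝ) (hfm : Measurable f) (hf : ∀ x, |f x| ≤ C) (t : ℝ) :
      ∫ x, f x * ((1 - t) * u₀ x + t * u₁ x) ∂m =
        (1 - t) * ∫ x, f x * u₀ x ∂m + t * ∫ x, f x * u₁ x ∂m := by
    rw [← integral_const_mul, ← integral_const_mul, ← integral_add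
      ((hu₀.bdd_mul hfm.aestronglyMeasurable (hnb _ _ hf)).const_mul _)
      ((hu₁.bdd_mul hfm.aestronglyMeasurable (hnb _ _ hf)).const_mul _)]
    congr 1 with x
    ring
  set A := ∫ x, ψ x * u₀ x ∂m
  set A' := ∫ x, ψ x * u₁ x ∂m
  set B := ∫ x, χ x * u₁ x ∂m
  set B' := ∫ x, χ x * u₀ x ∂m
  -- The increment constants blow up at times `0` and `1`, so the estimate is used on `[ε, 1 - ε]`;
  -- the integrals of `ψ` and `χ` are affine in time and converge as `ε → 0`.
  have hlim : Filter.Tendsto (fun ε : ℝ ↦ (1 - ε) * A + ε * A' + ((1 - (1 - ε)) * B' + (1 - ε) * B))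
      (nhdsWithin 0 (Ioi 0)) (nhds (A + B)) := by
    have : Continuous fun ε : ℝ ↦ (1 - ε) * A + ε * A' + ((1 - (1 - ε)) * B' + (1 - ε) * B) := by
      fun_prop
    have := (this.tendsto 0).mono_left (nhdsWithin_le_nhds (s := Ioi 0))
    simpa using this
  refine le_of_tendsto hlim ?_
  filter_upwards [Ioo_mem_nhdsGT (show (0 : ℝ) < 1 / 2 by norm_num)] with ε hε
  have h1 := hF ε (1 - ε) hε.1 (by linarith [hε.2]) (by linarith [hε.1])
  have h2 := hFa ε hε.1 (by linarith [hε.2])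
  have h3 := hFb (1 - ε) (by linarith [hε.2]) (by linarith [hε.1])
  rw [hsplit ψ hψm hψ] at h2
  rw [hsplit χ hχm hχ] at h3
  linarith

theorem proposition2p3 {d : ℕ} {H : Type*} [TopologicalSpace H]
    (I : ModelWithCorners ℝ (EuclideanSpace ℝ (Fin d)) H)
    {M : Type*} [MetricSpace M] [SecondCountableTopology M] [ConnectedSpace M]
    [ChartedSpace H M] [IsManifold I ∞ M]
    [RiemannianBundle (fun x : M ↦ TangentSpace I x)]
    [IsContMDiffRiemannianBundle I ∞ (EuclideanSpace ℝ (Fin d)) (fun x : M ↦ TangentSpace I x)]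
    [IsRiemannianManifold I M]
    [MeasurableSpace M] [BorelSpace M]
    [IsFiniteMeasure (riemannianVolume I M)]
    (u₀ u₁ : M → ℝ)
    (hu₀ : IsProbabilityDensity (riemannianVolume I M) u₀)
    (hu₁ : IsProbabilityDensity (riemannianVolume I M) u₁)
    (hu₀_L2 : MemLp u₀ 2 (riemannianVolume I M))
    (hu₁_L2 : MemLp u₁ 2 (riemannianVolume I M))
    (hu₀_pos : ∀ᵐ x ∂(riemannianVolume I M), 0 < u₀ x)
    (f : M → ℝ) (G : ∀ x : M, TangentSpace I x)
    (hf : HasSobolevGradient I f G)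
    (hsol : IsWeakNeumannGradient I G (fun x ↦ u₁ x - u₀ x)) :
    (wassersteinSq
        ((riemannianVolume I M).withDensity fun x ↦ ENNReal.ofReal (u₀ x))
        ((riemannianVolume I M).withDensity fun x ↦ ENNReal.ofReal (u₁ x)) ≤
      ∫⁻ s in Icc (0 : ℝ) 1, ∫⁻ x,
        ‖G x‖ₑ ^ 2 / ENNReal.ofReal ((1 - s) * u₀ x + s * u₁ x) ∂(riemannianVolume I M)) ∧
    (∫⁻ s in Icc (0 : ℝ) 1, ∫⁻ x,
        ‖G x‖ₑ ^ 2 / ENNReal.ofReal ((1 - s) * u₀ x + s * u₁ x) ∂(riemannianVolume I M) =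
      ∫⁻ x, ‖G x‖ₑ ^ 2 / ENNReal.ofReal (logMean (u₀ x) (u₁ x)) ∂(riemannianVolume I M)) := by
  have h₁ := hu₁.nonneg
  have hGm : AEStronglyMeasurable (fun x ↦ ‖G x‖) (riemannianVolume I M) :=
    hf.memLp_gradient.aestronglyMeasurable
  have hgm : AEMeasurable (fun x ↦ ‖G x‖ₑ ^ 2) (riemannianVolume I M) := by
    have := hGm.aemeasurable.ennreal_ofReal.pow_const 2
    simpa only [ofReal_norm] using this
  refine ⟨?_, lintegral_lintegral_div_segment hu₀.integrable.aemeasurable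
    hu₁.integrable.aemeasurable hu₀_pos h₁ hgm fun x ↦ by finiteness⟩
  set R := ∫⁻ s in Icc (0 : ℝ) 1, ∫⁻ x,
    ‖G x‖ₑ ^ 2 / ENNReal.ofReal ((1 - s) * u₀ x + s * u₁ x) ∂(riemannianVolume I M) with hR
  by_cases htop : R = ⊤
  · rw [htop]
    exact le_top
  have hRE : ∫⁻ r in Icc (0 : ℝ) 1, ∫⁻ x, ENNReal.ofReal (‖G x‖ ^ 2 /
      ((1 - r) * u₀ x + r * u₁ x)) ∂(riemannianVolume I M) ≤ ENNReal.ofReal R.toReal := by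
    rw [ENNReal.ofReal_toReal htop, hR]
    -- Real division by zero gives `0`, extended division may give `∞`; only this direction of the
    -- comparison is needed.
    refine lintegral_mono fun r ↦ lintegral_mono fun x ↦ ?_
    rw [← ofReal_norm, ← ENNReal.ofReal_pow (norm_nonneg _)]
    rcases lt_or_ge 0 ((1 - r) * u₀ x + r * u₁ x) with h | h
    · rw [ENNReal.ofReal_div_of_pos h]
    · rw [ENNReal.ofReal_of_nonpos (div_nonpos_of_nonneg_of_nonpos (sq_nonneg _) h)]
      exact zero_le
  have : IsManifold I 1 M := IsManifold.of_le (n := ∞) (by simp)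
  have : IsContinuousRiemannianBundle (EuclideanSpace ℝ (Fin d))
      (fun x : M ↦ TangentSpace I x) := by
    obtain ⟨g, hg, h⟩ := IsContMDiffRiemannianBundle.exists_contMDiff (IB := I) (n := ∞)
      (F := EuclideanSpace ℝ (Fin d)) (E := fun x : M ↦ TangentSpace I x)
    exact ⟨g, hg.continuous, h⟩
  have := hu₀.isProbabilityMeasure
  have := hu₁.isProbabilityMeasure
  rw [← ENNReal.ofReal_toReal htop]
  refine wassersteinSq_le_of_forall_potentials ENNReal.toReal_nonneg
    fun ψ χ hψm hχm ⟨C, hψ⟩ ⟨C', hχ⟩ hψχ ↦ ?_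
  rw [hu₀.integral_withDensity, hu₁.integral_withDensity]
  exact integral_potentials_le_action hu₀.integrable hu₁.integrable hu₀_pos h₁ hGm hsol
    ENNReal.toReal_nonneg hRE hψm hχm (C := max C C') (fun x ↦ (hψ x).trans (le_max_left _ _))
    (fun x ↦ (hχ x).trans (le_max_right _ _)) hψχ
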